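/- **Setting.** *Fundamental objects* are the finite bracketed products of $\mathbb 1$ and $\mathbb N$. The theory $\mathbf{PR}$ has the map terms generated from identities, terminal maps $!$, projections $\ell, r$, $0:\mathbb 1\to\mathbb N$ and $s:\mathbb N\to\mathbb N$ by composition, induced maps $(f,g)$ and iteration $f\mapsto f^\S: A\times\mathbb N\to A$. Its equality of maps is the least congruence that satisfies the category laws, uniqueness of $!$, $\ell\circ(f,g)=f$, $r\circ(f,g)=g$, $(\ell\circ h,r\circ h)=h$, $f^\S\circ(\mathrm{id},0)=\mathrm{id}$, $f^\S\circ(A\times s)=f\circ f^\S$ and Freyd's rule: if $h\circ(\mathrm{id},0)=f$ and $h\circ(A\times s)=g\circ h$, then $h=g^\S\circ(f\times\mathbb N)$. Let $E$ be any set of additional equations between map terms ($E=\emptyset$ is allowed). Let $\mathbf S$ be the theory $(\mathbf{PR}+E)$ with predicate abstraction: its objects are $\{A\mid\chi\}$ with $A$ fundamental and $\chi:A\to\mathbb N$ a predicate ($\mathrm{sign}\circ\chi=\chi$). Its maps $\{A\mid\chi\}\to\{B\mid\psi\}$ are the maps $f:A\to B$ for which $\mathbf{PR}+E$ derives $\chi\Rightarrow\psi\circ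 f$, and $f=g$ in $\mathbf S$ means that $\mathbf{PR}+E$ derives $\chi\Rightarrow f\doteq g$, where $\doteq$ is predicative equality. For $E=\emptyset$ this is $\mathbf{PR_A}$; general $E$ gives its strengthenings. Let $2=\{n\in\mathbb N\mid n<2\}$. A *partial map* $f:A\rightharpoonup B$ over $\mathbf S$ is a pair of $\mathbf S$-maps $d_f:D_f\to A$, $\widehat f:D_f\to B$ for which $\mathbf S$ derives $d_f(x)\doteq d_f(x')\Rightarrow\widehat f(x)\doteq\widehat f(x')$. Partial equality $f\,\widehat=\,g$ means that there are $\mathbf S$-maps $D_f\to D_g$ and $D_g\to D_f$ compatible with $d$ and with the rules. Composition $\widehat\circ$ is by pullback, and $\widehat{\mathbf S}$ is the resulting category, with the objects of $\mathbf S$ and with partial maps up to $\widehat=$. An $\mathbf S$-map $q:\{A\mid\gamma\}\to B$ on a decidable part of $A$ is also regarded as a (*defined partial*) map $A\rightharpoonup B$. For an $\mathbf S$-predicate $\varphi:A\times\mathbb N\to2$ the partial map $\mu\varphi:A\rightharpoonup\mathbb N$ has $D=\{A\times\mathbb N\mid\varphi\}$, $d(a,n)=a$ and rule $\min\{m\le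 n\mid\varphi(a,m)\}$. For $\mathbf S$-maps $\chi:A\to2$, $f:A\to A$ the loop $\mathrm{wh}[\chi\mid f]:A\rightharpoonup A$ is $f^\S\,\widehat\circ\,(A\times\mu\varphi)\,\widehat\circ\,\Delta_A$ with $\varphi(a,n)=\neg\chi f^n(a)$. Iteration of partial maps is defined through finite sequences of witnesses in $D_f$; for partial predicates $\varphi:A\times\mathbb N\rightharpoonup2$, $\mu\varphi(a)=n$ means that $\varphi(a,n)$ is defined and true and $\varphi(a,m)$ is defined and false for all $m<n$; loops with partial $\chi,f$ are given by the same formula as before. For $k\ge0$, the $\mu$-recursive maps of level $\le k$ over $\mathbf S$ are generated from the (defined partial) $\mathbf S$-maps by composition, product $\times$, iteration, $\mu$ on $\mathbf S$-predicates (giving level $1$), and $\mu$ on partial predicates of level $j\ge1$ (giving level $j+1$). Let $\mu^k\mathbf S$ be the theory of these maps up to $\widehat=$, $\mu\mathbf S=\mu^1\mathbf S$, $\mu\mu\mathbf S=\mu^2\mathbf S$ (so $\mu\mathbf{PR_A}=\mu\mathbf R$). Similarly, $\mathbf{While}^k\mathbf S$ consists of the maps generated from the (defined partial) $\mathbf S$-maps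 by composition, product and while loops nested to depth at most $k$. **Theorem.** For every such theory $\mathbf S$: 1. Let $f:A\rightharpoonup B$ be a partial map, $D_f=\{D\mid\delta\}$, let $\mathrm{cnt}_D:\mathbb N\to D$ be the canonical (Cantor) count of the fundamental object $D$, and let $\varphi_f:A\times\mathbb N\to2$ be the $\mathbf S$-predicate $\varphi_f(a,n)=[\delta(\mathrm{cnt}_D(n))\wedge a\doteq d_f(\mathrm{cnt}_D(n))]$. Then $\mu\varphi_f$ and $(\widehat f\circ\mathrm{cnt}_D)\,\widehat\circ\,\mu\varphi_f$ are partial maps and $$f\;\widehat=\;(\widehat f\circ\mathrm{cnt}_D)\,\widehat\circ\,\mu\varphi_f,$$ where $\widehat f\circ\mathrm{cnt}_D$ is taken as a defined partial map $\mathbb N\rightharpoonup B$ on $\{n\mid\delta(\mathrm{cnt}_D(n))\}$; whenever $\widehat f\circ\mathrm{cnt}_D$ is an $\mathbf S$-map $\mathbb N\to B$, the equation also holds with this total map. 2. For every $k\ge1$ the theories $\mu^k\mathbf S$ and $\widehat{\mathbf S}$ are categories, $\mu^k\mathbf S$ is contained in $\widehat{\mathbf S}$, and the inclusion functor $\mu^k\mathbf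 S\to\widehat{\mathbf S}$ is an equivalence of categories. In particular $\mu\mathbf S\simeq\widehat{\mathbf S}$, and $\mu\mathbf R\simeq\widehat{\mathbf{PR_A}}$. 3. The inclusion $\mu\mathbf S\to\mu\mu\mathbf S$, and more generally $\mu\mathbf S\to\mu^k\mathbf S$ for every $k\ge1$, is an equivalence. Every $\mu$-recursive map of any level $k\ge 0$ is, up to $\widehat=$, of the form $q\,\widehat\circ\,\mu\varphi$ with one $\mathbf S$-predicate $\varphi$ and one (defined partial) $\mathbf S$-map $q$. 4. One while loop suffices: every partial map over $\mathbf S$, and every map given by a while program of any nesting depth $k\ge 0$, is, up to $\widehat=$, of the form $q\,\widehat\circ\,\mathrm{wh}[\chi\mid g]\,\widehat\circ\,p$ with $\mathbf S$-maps $p:A\to C$, $\chi:C\to2$, $g:C\to C$ and a (defined partial) $\mathbf S$-map $q:C\rightharpoonup B$; these can be chosen so that, if the map of fundamental objects underlying $q$ is an $\mathbf S$-map $C\to B$, this total map may be used in place of $q$. For every $k\ge1$ the inclusion $\mathbf{While}^k\mathbf S\to\widehat{\mathbf S}$ exists and is an equivalence of categories. -/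

import Mathlib

namespace PRM

open CategoryTheory

/-! ## The theory `PR` of primitive recursion and its strengthenings -/

/-- Fundamental objects: the bracketed finite powers of `ℕ`. -/
inductive Ob : Type
  | one : Ob
  | nat : Ob
  | prod (A B : Ob) : Ob

/-- Map terms of the theory `PR`. The induced map `pair f g = (f, g)` is taken as a basic operation;
the diagonal is `(id, id)` and cylindrification `A × g` is `(ℓ, g ∘ r)`. The term `iter f` is the
iterated `f^§ : A × ℕ → A` of an endomap `f`. -/
inductive Tm : Ob → Ob → Type
  | id (A : Ob) : Tm A A
  | comp {A B C : Ob} (g : Tm B C) (f : Tm A B) : Tm A C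
  | bang (A : Ob) : Tm A Ob.one
  | pair {C A B : Ob} (f : Tm C A) (g : Tm C B) : Tm C (Ob.prod A B)
  | fst (A B : Ob) : Tm (Ob.prod A B) A
  | snd (A B : Ob) : Tm (Ob.prod A B) B
  | zero : Tm Ob.one Ob.nat
  | succ : Tm Ob.nat Ob.nat
  | iter {A : Ob} (f : Tm A A) : Tm (Ob.prod A Ob.nat) A

/-- A set of additional equations between map terms. -/
abbrev Eqns : Type := ∀ ⦃A B : Ob⦄, Tm A B → Tm A B → Prop

/-- `Deriv E f g`: the theory `PR + E` derives `f = g`. For `E` empty this is the theory `PR`; a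
general `E` gives a general strengthening of `PR`. -/
inductive Deriv (E : Eqns) : ∀ {A B : Ob}, Tm A B → Tm A B → Prop
  | extra {A B : Ob} {f g : Tm A B} (h : E f g) : Deriv E f g
  | refl {A B : Ob} (f : Tm A B) : Deriv E f f
  | symm {A B : Ob} {f g : Tm A B} (h : Deriv E f g) : Deriv E g f
  | trans {A B : Ob} {f g h : Tm A B} (h₁ : Deriv E f g) (h₂ : Deriv E g h) : Deriv E f h
  | comp_congr {A B C : Ob} {g g' : Tm B C} {f f' : Tm A B}
      (h₁ : Deriv E g g') (h₂ : Deriv E f f') : Deriv E (Tm.comp g f) (Tm.comp g' f')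
  | pair_congr {C A B : Ob} {f f' : Tm C A} {g g' : Tm C B}
      (h₁ : Deriv E f f') (h₂ : Deriv E g g') : Deriv E (Tm.pair f g) (Tm.pair f' g')
  | iter_congr {A : Ob} {f f' : Tm A A} (h : Deriv E f f') : Deriv E (Tm.iter f) (Tm.iter f')
  | id_comp {A B : Ob} (f : Tm A B) : Deriv E (Tm.comp (Tm.id B) f) f
  | comp_id {A B : Ob} (f : Tm A B) : Deriv E (Tm.comp f (Tm.id A)) f
  | assoc {A B C D : Ob} (h : Tm C D) (g : Tm B C) (f : Tm A B) :
      Deriv E (Tm.comp (Tm.comp h g) f) (Tm.comp h (Tm.comp g f))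
  | bang_uniq {A : Ob} (f : Tm A Ob.one) : Deriv E f (Tm.bang A)
  /-- Godement's equations. -/
  | fst_pair {C A B : Ob} (f : Tm C A) (g : Tm C B) :
      Deriv E (Tm.comp (Tm.fst A B) (Tm.pair f g)) f
  | snd_pair {C A B : Ob} (f : Tm C A) (g : Tm C B) :
      Deriv E (Tm.comp (Tm.snd A B) (Tm.pair f g)) g
  /-- Fourman's equation. -/
  | pair_eta {C A B : Ob} (h : Tm C (Ob.prod A B)) :
      Deriv E (Tm.pair (Tm.comp (Tm.fst A B) h) (Tm.comp (Tm.snd A B) h)) h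
  /-- `f^§ ∘ (id, 0 !) = id`. -/
  | iter_zero {A : Ob} (f : Tm A A) :
      Deriv E (Tm.comp (Tm.iter f) (Tm.pair (Tm.id A) (Tm.comp Tm.zero (Tm.bang A)))) (Tm.id A)
  /-- `f^§ ∘ (A × s) = f ∘ f^§`. -/
  | iter_succ {A : Ob} (f : Tm A A) :
      Deriv E
        (Tm.comp (Tm.iter f) (Tm.pair (Tm.fst A Ob.nat) (Tm.comp Tm.succ (Tm.snd A Ob.nat))))
        (Tm.comp f (Tm.iter f))
  /-- Freyd's uniqueness of the initialised iterated. -/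
  | freyd {A B : Ob} (f : Tm A B) (g : Tm B B) (h : Tm (Ob.prod A Ob.nat) B)
      (init : Deriv E (Tm.comp h (Tm.pair (Tm.id A) (Tm.comp Tm.zero (Tm.bang A)))) f)
      (step : Deriv E
        (Tm.comp h (Tm.pair (Tm.fst A Ob.nat) (Tm.comp Tm.succ (Tm.snd A Ob.nat))))
        (Tm.comp g h)) :
      Deriv E h
        (Tm.comp (Tm.iter g) (Tm.pair (Tm.comp f (Tm.fst A Ob.nat)) (Tm.snd A Ob.nat)))

/-- Derivable equality as a setoid. -/
def derivSetoid (E : Eqns) (A B : Ob) : Setoid (Tm A B) where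
  r := Deriv E
  iseqv := ⟨Deriv.refl, Deriv.symm, Deriv.trans⟩

/-- Maps of the theory `PR + E`: map terms up to derivable equality, so that `f = g` in
`Mor E A B` says that `PR + E` derives the equation. -/
def Mor (E : Eqns) (A B : Ob) : Type := Quotient (derivSetoid E A B)

variable {E : Eqns}

namespace Mor

/-- The class of a map term. -/
def mk {A B : Ob} (f : Tm A B) : Mor E A B := Quotient.mk (derivSetoid E A B) f

def id (A : Ob) : Mor E A A := mk (Tm.id A)

def comp {A B C : Ob} (g : Mor E B C) (f : Mor E A B) : Mor E A C :=
  Quotient.map₂ (sa := derivSetoid E B C) (sb := derivSetoid E A B) (sc := derivSetoid E A C)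
    Tm.comp (fun _ _ h₁ _ _ h₂ => Deriv.comp_congr h₁ h₂) g f

def bang (A : Ob) : Mor E A Ob.one := mk (Tm.bang A)

def pair {C A B : Ob} (f : Mor E C A) (g : Mor E C B) : Mor E C (Ob.prod A B) :=
  Quotient.map₂ (sa := derivSetoid E C A) (sb := derivSetoid E C B)
    (sc := derivSetoid E C (Ob.prod A B))
    Tm.pair (fun _ _ h₁ _ _ h₂ => Deriv.pair_congr h₁ h₂) f g

def fst {A B : Ob} : Mor E (Ob.prod A B) A := mk (Tm.fst A B)

def snd {A B : Ob} : Mor E (Ob.prod A B) B := mk (Tm.snd A B)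

def zero : Mor E Ob.one Ob.nat := mk Tm.zero

def succ : Mor E Ob.nat Ob.nat := mk Tm.succ

def iter {A : Ob} (f : Mor E A A) : Mor E (Ob.prod A Ob.nat) A :=
  Quotient.map (sa := derivSetoid E A A) (sb := derivSetoid E (Ob.prod A Ob.nat) A)
    Tm.iter (fun _ _ h => Deriv.iter_congr h) f

end Mor

open Mor

infixr:80 " ⊚ " => Mor.comp

namespace Mor

theorem ind {A B : Ob} {P : Mor E A B → Prop} (h : ∀ f, P (mk f)) (f : Mor E A B) : P f :=
  Quotient.ind h f

theorem sound {A B : Ob} {f g : Tm A B} (h : Deriv E f g) : (mk f : Mor E A B) = mk g :=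
  Quotient.sound (s := derivSetoid E A B) h

theorem exact {A B : Ob} {f g : Tm A B} (h : (mk f : Mor E A B) = mk g) : Deriv E f g :=
  Quotient.exact (s := derivSetoid E A B) h

@[simp] theorem id_comp {A B : Ob} (f : Mor E A B) : Mor.id B ⊚ f = f := by
  induction f using Mor.ind with | _ f => exact sound (Deriv.id_comp f)

@[simp] theorem comp_id {A B : Ob} (f : Mor E A B) : f ⊚ Mor.id A = f := by
  induction f using Mor.ind with | _ f => exact sound (Deriv.comp_id f)

@[simp] theorem assoc {A B C D : Ob} (h : Mor E C D) (g : Mor E B C) (f : Mor E A B) :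
    (h ⊚ g) ⊚ f = h ⊚ g ⊚ f := by
  induction f using Mor.ind with | _ f =>
  induction g using Mor.ind with | _ g =>
  induction h using Mor.ind with | _ h => exact sound (Deriv.assoc h g f)

theorem bang_uniq {A : Ob} (f g : Mor E A Ob.one) : f = g := by
  induction f using Mor.ind with | _ f =>
  induction g using Mor.ind with | _ g =>
  exact sound ((Deriv.bang_uniq f).trans (Deriv.bang_uniq g).symm)

@[simp] theorem bang_comp {A B : Ob} (f : Mor E A B) : bang B ⊚ f = bang A := bang_uniq _ _

@[simp] theorem fst_pair {C A B : Ob} (f : Mor E C A) (g : Mor E C B) : fst ⊚ pair f g = f := by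
  induction f using Mor.ind with | _ f =>
  induction g using Mor.ind with | _ g => exact sound (Deriv.fst_pair f g)

@[simp] theorem snd_pair {C A B : Ob} (f : Mor E C A) (g : Mor E C B) : snd ⊚ pair f g = g := by
  induction f using Mor.ind with | _ f =>
  induction g using Mor.ind with | _ g => exact sound (Deriv.snd_pair f g)

theorem pair_eta {C A B : Ob} (h : Mor E C (Ob.prod A B)) : pair (fst ⊚ h) (snd ⊚ h) = h := by
  induction h using Mor.ind with | _ h => exact sound (Deriv.pair_eta h)

@[simp] theorem pair_comp {D C A B : Ob} (f : Mor E C A) (g : Mor E C B) (h : Mor E D C) :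
    pair f g ⊚ h = pair (f ⊚ h) (g ⊚ h) := by
  rw [← pair_eta (pair f g ⊚ h), ← assoc, ← assoc, fst_pair, snd_pair]

@[simp] theorem pair_fst_snd {A B : Ob} :
    (pair fst snd : Mor E (Ob.prod A B) (Ob.prod A B)) = Mor.id _ := by
  simpa using pair_eta (Mor.id (E := E) (Ob.prod A B))

@[simp] theorem iter_zero {C A : Ob} (f : Mor E A A) (x : Mor E C A) (y : Mor E C Ob.one) :
    iter f ⊚ pair x (zero ⊚ y) = x := by
  have h : iter f ⊚ pair (Mor.id A) (zero ⊚ bang A) = Mor.id A := by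
    induction f using Mor.ind with | _ f => exact sound (Deriv.iter_zero f)
  have h' := congrArg (fun k => k ⊚ x) h
  simpa [bang_uniq y (bang C)] using h'

@[simp] theorem iter_succ {C A : Ob} (f : Mor E A A) (x : Mor E C A) (n : Mor E C Ob.nat) :
    iter f ⊚ pair x (succ ⊚ n) = f ⊚ iter f ⊚ pair x n := by
  have h : iter f ⊚ pair fst (succ ⊚ snd) = f ⊚ iter f := by
    induction f using Mor.ind with | _ f => exact sound (Deriv.iter_succ f)
  have h' := congrArg (fun k => k ⊚ pair x n) h
  simpa using h'

theorem freyd {A B : Ob} (g : Mor E B B) (h : Mor E (Ob.prod A Ob.nat) B)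
    (step : h ⊚ pair fst (succ ⊚ snd) = g ⊚ h) :
    h = iter g ⊚ pair ((h ⊚ pair (Mor.id A) (zero ⊚ bang A)) ⊚ fst) snd := by
  induction g using Mor.ind with | _ g =>
  induction h using Mor.ind with | _ h =>
  exact sound (Deriv.freyd _ g h (Deriv.refl _) (exact step))

/-- Two maps with the same initial values and the same step map are equal. -/
theorem freyd_ext {A B : Ob} (g : Mor E B B) (h h' : Mor E (Ob.prod A Ob.nat) B)
    (init : h ⊚ pair (Mor.id A) (zero ⊚ bang A) = h' ⊚ pair (Mor.id A) (zero ⊚ bang A))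
    (step : h ⊚ pair fst (succ ⊚ snd) = g ⊚ h)
    (step' : h' ⊚ pair fst (succ ⊚ snd) = g ⊚ h') : h = h' := by
  rw [freyd g h step, freyd g h' step', init]

/-- The full schema of primitive recursion: `prr g h (a, 0) = g a` and
`prr g h (a, s n) = h ((a, n), prr g h (a, n))`. -/
def prr {A B : Ob} (g : Mor E A B) (h : Mor E (Ob.prod (Ob.prod A Ob.nat) B) B) :
    Mor E (Ob.prod A Ob.nat) B :=
  snd ⊚ iter (pair (pair (fst ⊚ fst) (succ ⊚ snd ⊚ fst)) h) ⊚
    pair (pair (pair fst (zero ⊚ bang _)) (g ⊚ fst)) snd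

@[simp] theorem prr_zero {C A B : Ob} (g : Mor E A B)
    (h : Mor E (Ob.prod (Ob.prod A Ob.nat) B) B) (x : Mor E C A) (y : Mor E C Ob.one) :
    prr g h ⊚ pair x (zero ⊚ y) = g ⊚ x := by
  simp [prr]

theorem prr_aux {A B : Ob} (g : Mor E A B) (h : Mor E (Ob.prod (Ob.prod A Ob.nat) B) B) :
    fst ⊚ iter (pair (pair (fst ⊚ fst) (succ ⊚ snd ⊚ fst)) h) ⊚
      pair (pair (pair fst (zero ⊚ bang _)) (g ⊚ fst)) snd = Mor.id (Ob.prod A Ob.nat) := by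
  apply freyd_ext (pair fst (succ ⊚ snd))
  · simp
  · simp
  · simp

@[simp] theorem prr_succ {C A B : Ob} (g : Mor E A B)
    (h : Mor E (Ob.prod (Ob.prod A Ob.nat) B) B) (x : Mor E C A) (n : Mor E C Ob.nat) :
    prr g h ⊚ pair x (succ ⊚ n) = h ⊚ pair (pair x n) (prr g h ⊚ pair x n) := by
  have key := congrArg (fun k => k ⊚ pair x n) (prr_aux g h)
  simp only [assoc, pair_comp, fst_pair, snd_pair, bang_comp, id_comp] at key
  simp only [prr, assoc, pair_comp, fst_pair, snd_pair, bang_comp, iter_succ]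
  congr 1
  conv_lhs => rw [← pair_eta (iter _ ⊚ _), key]

/-- Uniqueness of maps defined by case distinction. -/
theorem cases_ext {A B : Ob} {f g : Mor E (Ob.prod A Ob.nat) B}
    (h₀ : f ⊚ pair (Mor.id A) (zero ⊚ bang A) = g ⊚ pair (Mor.id A) (zero ⊚ bang A))
    (h₁ : f ⊚ pair fst (succ ⊚ snd) = g ⊚ pair fst (succ ⊚ snd)) : f = g := by
  have key : pair (Mor.id (Ob.prod A Ob.nat)) f = pair (Mor.id _) g := by
    apply freyd_ext (pair (pair (fst ⊚ fst) (succ ⊚ snd ⊚ fst))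
      (f ⊚ pair (fst ⊚ fst) (succ ⊚ snd ⊚ fst)))
    · simp [h₀]
    · simp
    · simp [h₁]
  simpa using congrArg (fun k => snd ⊚ k) key

/-! ### Arithmetic and Boolean logic -/

/-- Truth `1`, as a constant map on `A`. -/
def tt (A : Ob) : Mor E A Ob.nat := succ ⊚ zero ⊚ bang A

/-- Falsehood `0`, as a constant map on `A`. -/
def ff (A : Ob) : Mor E A Ob.nat := zero ⊚ bang A

/-- Addition `a + n`. -/
def add : Mor E (Ob.prod Ob.nat Ob.nat) Ob.nat := iter succ

/-- Predecessor. -/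
def pre : Mor E Ob.nat Ob.nat := prr zero (snd ⊚ fst) ⊚ pair (bang _) (Mor.id _)

/-- Truncated subtraction. -/
def sub : Mor E (Ob.prod Ob.nat Ob.nat) Ob.nat := iter pre

/-- Multiplication: `a · 0 = 0`, `a · s n = a · n + a`. -/
def mul : Mor E (Ob.prod Ob.nat Ob.nat) Ob.nat :=
  prr (ff _) (add ⊚ pair snd (fst ⊚ fst))

/-- `sign 0 = 0`, `sign (s n) = 1`. -/
def sign : Mor E Ob.nat Ob.nat := prr zero (tt _) ⊚ pair (bang _) (Mor.id _)

/-- `neg 0 = 1`, `neg (s n) = 0`. -/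
def neg : Mor E Ob.nat Ob.nat := prr (succ ⊚ zero) (ff _) ⊚ pair (bang _) (Mor.id _)

/-- Conjunction `p ∧ q = sign (p · q)`. -/
def band {A : Ob} (p q : Mor E A Ob.nat) : Mor E A Ob.nat := sign ⊚ mul ⊚ pair p q

/-- Negation. -/
def bneg {A : Ob} (p : Mor E A Ob.nat) : Mor E A Ob.nat := neg ⊚ p

/-- Implication `p ⟹ q`, that is `¬ (p ∧ ¬ q)`. -/
def bimp {A : Ob} (p q : Mor E A Ob.nat) : Mor E A Ob.nat := bneg (band p (bneg q))

/-- The order `p ≤ q`. -/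
def ble {A : Ob} (p q : Mor E A Ob.nat) : Mor E A Ob.nat := neg ⊚ sub ⊚ pair p q

/-- The strict order `p < q`. -/
def blt {A : Ob} (p q : Mor E A Ob.nat) : Mor E A Ob.nat := sign ⊚ sub ⊚ pair q p

/-- Predicative equality `f ≐ g` of maps into a fundamental object, as a predicate. -/
def beq : ∀ {B A : Ob}, Mor E A B → Mor E A B → Mor E A Ob.nat
  | Ob.one, A, _, _ => tt A
  | Ob.nat, _, f, g => band (ble f g) (ble g f)
  | Ob.prod _ _, _, f, g => band (beq (fst ⊚ f) (fst ⊚ g)) (beq (snd ⊚ f) (snd ⊚ g))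

/-- Case distinction: `x` if `c` is true (not zero), `y` otherwise. -/
def ite {A B : Ob} (c : Mor E A Ob.nat) (x y : Mor E A B) : Mor E A B :=
  prr snd (fst ⊚ fst ⊚ fst) ⊚ pair (pair x y) c

/-- `Entails p q`: the theory derives `p ⟹ q`. -/
def Entails {A : Ob} (p q : Mor E A Ob.nat) : Prop := bimp p q = tt A

/-- Bounded minimum `(a, n) ↦ min {m ≤ n | φ (a, m)}` (equal to `n` if there is no such `m`):
it is `0` at `n = 0`, and at `s n` it is the minimum `m` up to `n` if `φ (a, m)`, else `s n`. -/
def bmin {A : Ob} (φ : Mor E (Ob.prod A Ob.nat) Ob.nat) : Mor E (Ob.prod A Ob.nat) Ob.nat :=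
  prr (ff A) (ite (φ ⊚ pair (fst ⊚ fst) snd) snd (succ ⊚ snd ⊚ fst))

/-- The Cantor enumeration `ℕ → ℕ × ℕ` along the diagonals: it starts in `(0, 0)` and goes on by
`(x, 0) ↦ (0, s x)` and `(x, s y) ↦ (s x, y)`. -/
def cantor : Mor E Ob.nat (Ob.prod Ob.nat Ob.nat) :=
  iter (ite snd (pair (succ ⊚ fst) (pre ⊚ snd)) (pair (ff _) (succ ⊚ fst))) ⊚
    pair (pair (ff _) (ff _)) (Mor.id _)

/-- The canonical count `ℕ → D` of a fundamental object. -/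
def cnt : ∀ D : Ob, Mor E Ob.nat D
  | Ob.one => bang _
  | Ob.nat => Mor.id _
  | Ob.prod A B => pair (cnt A ⊚ fst) (cnt B ⊚ snd) ⊚ cantor

/-! ### Facts of Boolean logic -/

@[simp] theorem ff_comp {A B : Ob} (f : Mor E A B) : ff B ⊚ f = ff A := by simp [ff]

@[simp] theorem tt_comp {A B : Ob} (f : Mor E A B) : tt B ⊚ f = tt A := by simp [tt]

theorem zero_eq_ff {A : Ob} (y : Mor E A Ob.one) : zero ⊚ y = ff A := by
  rw [ff, bang_uniq y (bang A)]

theorem succ_ff {A : Ob} : succ ⊚ ff A = (tt A : Mor E A _) := rfl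

@[simp] theorem sign_zero {A : Ob} : sign ⊚ ff A = (ff A : Mor E A _) := by simp [sign, ff]

@[simp] theorem sign_succ {A : Ob} (n : Mor E A Ob.nat) : sign ⊚ succ ⊚ n = tt A := by
  simp [sign]

@[simp] theorem neg_zero {A : Ob} : neg ⊚ ff A = (tt A : Mor E A _) := by simp [neg, ff, tt]

@[simp] theorem neg_succ {A : Ob} (n : Mor E A Ob.nat) : neg ⊚ succ ⊚ n = ff A := by
  simp [neg]

@[simp] theorem sign_tt {A : Ob} : sign ⊚ tt A = (tt A : Mor E A _) := by
  rw [← succ_ff, sign_succ, succ_ff]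

@[simp] theorem neg_tt {A : Ob} : neg ⊚ tt A = (ff A : Mor E A _) := by
  rw [← succ_ff, neg_succ]

@[simp] theorem pre_succ {A : Ob} (n : Mor E A Ob.nat) : pre ⊚ succ ⊚ n = n := by
  simp [pre]

theorem band_comp {A C : Ob} (p q : Mor E A Ob.nat) (t : Mor E C A) :
    band p q ⊚ t = band (p ⊚ t) (q ⊚ t) := by simp [band]

theorem bneg_comp {A C : Ob} (p : Mor E A Ob.nat) (t : Mor E C A) :
    bneg p ⊚ t = bneg (p ⊚ t) := by simp [bneg]

theorem bimp_comp {A C : Ob} (p q : Mor E A Ob.nat) (t : Mor E C A) :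
    bimp p q ⊚ t = bimp (p ⊚ t) (q ⊚ t) := by simp [bimp, bneg, band]

/-- Case distinction on a generalised element. -/
theorem cases_elt {A B C : Ob} (f g : Mor E (Ob.prod A Ob.nat) B)
    (h₀ : f ⊚ pair (Mor.id A) (ff A) = g ⊚ pair (Mor.id A) (ff A))
    (h₁ : f ⊚ pair fst (succ ⊚ snd) = g ⊚ pair fst (succ ⊚ snd))
    (a : Mor E C A) (p : Mor E C Ob.nat) : f ⊚ pair a p = g ⊚ pair a p := by
  rw [cases_ext h₀ h₁]

/-- Case distinction on a generalised element, without parameter. -/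
theorem cases_elt' {B C : Ob} (f g : Mor E Ob.nat B)
    (h₀ : f ⊚ ff Ob.one = g ⊚ ff Ob.one) (h₁ : f ⊚ succ = g ⊚ succ)
    (p : Mor E C Ob.nat) : f ⊚ p = g ⊚ p := by
  have h := cases_elt (A := Ob.one) (f ⊚ snd) (g ⊚ snd) (by simpa using h₀)
    (by
      have := congrArg (fun k => k ⊚ (snd : Mor E (Ob.prod Ob.one Ob.nat) _)) h₁
      simpa using this) (bang C) p
  simpa using h

@[simp] theorem band_zero_right {A : Ob} (p : Mor E A Ob.nat) : band p (ff A) = ff A := by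
  have : mul ⊚ pair p (ff A) = ff A := by
    rw [ff, mul, prr_zero, ff_comp, ff]
  rw [band, this, sign_zero]

theorem zero_mul : mul ⊚ pair (ff _) (Mor.id _) = (ff Ob.nat : Mor E _ _) := by
  have key : mul ⊚ pair (ff _) snd = (ff (Ob.prod Ob.one Ob.nat) : Mor E _ _) := by
    apply freyd_ext (Mor.id _)
    · simp [mul, ff]
    · have h : ∀ x : Mor E (Ob.prod Ob.one Ob.nat) Ob.nat,
          add ⊚ pair x (ff _) = x := fun x => by simp [add, ff]
      simp [mul, h]
    · simp
  simpa using congrArg (fun k => k ⊚ pair (bang _) (Mor.id _)) key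

@[simp] theorem band_zero_left {A : Ob} (q : Mor E A Ob.nat) : band (ff A) q = ff A := by
  have h := congrArg (fun k => k ⊚ q) (zero_mul (E := E))
  simp only [assoc, pair_comp, ff_comp, id_comp] at h
  rw [band, h, sign_zero]

@[simp] theorem band_succ_succ {A : Ob} (p q : Mor E A Ob.nat) :
    band (succ ⊚ p) (succ ⊚ q) = tt A := by
  have h : ∀ x : Mor E A Ob.nat, add ⊚ pair x (succ ⊚ p) = succ ⊚ add ⊚ pair x p :=
    fun x => by simp [add]
  simp [band, mul, h]

@[simp] theorem band_succ_left {A : Ob} (p q : Mor E A Ob.nat) :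
    band (succ ⊚ p) q = sign ⊚ q := by
  have h := cases_elt (E := E) (A := Ob.nat) (band (succ ⊚ fst) snd) (sign ⊚ snd)
    (by simp [band_comp]) (by simp [band_comp]) p q
  simpa [band_comp] using h

theorem sign_succ' : sign ⊚ succ = (tt Ob.nat : Mor E _ _) := by
  simpa using sign_succ (E := E) (Mor.id _)

theorem neg_succ' : neg ⊚ succ = (ff Ob.nat : Mor E _ _) := by
  simpa using neg_succ (E := E) (Mor.id _)

@[simp] theorem sign_sign {A : Ob} (p : Mor E A Ob.nat) : sign ⊚ sign ⊚ p = sign ⊚ p := by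
  have h := cases_elt' (E := E) (sign ⊚ sign) sign (by simp) (by simp [sign_succ']) p
  simpa using h

theorem sign_band {A : Ob} (p q : Mor E A Ob.nat) : sign ⊚ band p q = band p q := by
  simp [band]

theorem band_comm {A : Ob} (p q : Mor E A Ob.nat) : band p q = band q p := by
  have h₁ : ∀ {C : Ob} (q n : Mor E C Ob.nat), band q (succ ⊚ n) = sign ⊚ q := by
    intro C q n
    have h := cases_elt (E := E) (A := Ob.nat) (band snd (succ ⊚ fst)) (sign ⊚ snd)
      (by simp [band_comp]) (by simp [band_comp]) n q
    simpa [band_comp] using h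
  have h := cases_elt (E := E) (A := Ob.nat) (band snd fst) (band fst snd)
    (by simp [band_comp]) (by simp [band_comp, h₁]) q p
  simpa [band_comp] using h

theorem band_succ_right {A : Ob} (p q : Mor E A Ob.nat) : band p (succ ⊚ q) = sign ⊚ p := by
  rw [band_comm, band_succ_left]

@[simp] theorem band_tt {A : Ob} (p : Mor E A Ob.nat) : band p (tt A) = sign ⊚ p :=
  band_succ_right _ _

theorem band_sign_left {A : Ob} (p q : Mor E A Ob.nat) : band (sign ⊚ p) q = band p q := by
  have h := cases_elt (E := E) (A := Ob.nat) (band (sign ⊚ snd) fst) (band snd fst)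
    (by simp [band_comp]) (by
      have : (tt _ : Mor E (Ob.prod Ob.nat Ob.nat) Ob.nat) = succ ⊚ ff _ := rfl
      simp only [band_comp, assoc, snd_pair, fst_pair, sign_succ, band_succ_left]
      rw [this, band_succ_left]) q p
  simpa [band_comp] using h

theorem band_sign_right {A : Ob} (p q : Mor E A Ob.nat) : band p (sign ⊚ q) = band p q := by
  rw [band_comm, band_sign_left, band_comm]

theorem band_self {A : Ob} (p : Mor E A Ob.nat) : band p p = sign ⊚ p := by
  have h := cases_elt' (E := E) (band (Mor.id _) (Mor.id _)) sign
    (by simp [band_comp]) (by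
      have := band_succ_succ (E := E) (Mor.id _) (Mor.id _)
      simp only [comp_id] at this
      simp [band_comp, sign_succ', this]) p
  simpa [band_comp] using h

theorem band_assoc {A : Ob} (p q r : Mor E A Ob.nat) :
    band (band p q) r = band p (band q r) := by
  have h := cases_elt (E := E) (A := Ob.prod Ob.nat Ob.nat)
    (band (band snd (fst ⊚ fst)) (snd ⊚ fst)) (band snd (band (fst ⊚ fst) (snd ⊚ fst)))
    (by simp [band_comp]) (by simp [band_comp, band_sign_left, sign_band]) (pair q r) p
  simpa [band_comp] using h

theorem sign_neg {A : Ob} (p : Mor E A Ob.nat) : sign ⊚ neg ⊚ p = neg ⊚ p := by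
  have h := cases_elt' (E := E) (sign ⊚ neg) neg (by simp) (by simp [neg_succ']) p
  simpa using h

theorem neg_neg {A : Ob} (p : Mor E A Ob.nat) : neg ⊚ neg ⊚ p = sign ⊚ p := by
  have h := cases_elt' (E := E) (neg ⊚ neg) sign (by simp) (by simp [neg_succ', sign_succ']) p
  simpa using h

theorem neg_sign {A : Ob} (p : Mor E A Ob.nat) : neg ⊚ sign ⊚ p = neg ⊚ p := by
  have h := cases_elt' (E := E) (neg ⊚ sign) neg (by simp) (by simp [neg_succ', sign_succ']) p
  simpa using h

theorem band_bimp {A : Ob} (p q : Mor E A Ob.nat) : band p (bimp p q) = band p q := by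
  have h := cases_elt (E := E) (A := Ob.nat) (band snd (bimp snd fst)) (band snd fst)
    (by simp [band_comp]) (by
      simp [band_comp, bimp, bneg, sign_neg, neg_neg]) q p
  simpa [band_comp, bimp_comp] using h

theorem bimp_band {A : Ob} (p q : Mor E A Ob.nat) : bimp p (band p q) = bimp p q := by
  have h := cases_elt (E := E) (A := Ob.nat) (bimp snd (band snd fst)) (bimp snd fst)
    (by simp [band_comp, bimp, bneg]) (by
      simp [band_comp, bimp, bneg, sign_neg, neg_neg]) q p
  simpa [band_comp, bimp_comp] using h

theorem bimp_sign_self {A : Ob} (p : Mor E A Ob.nat) : bimp p (sign ⊚ p) = tt A := by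
  have h := cases_elt' (E := E) (bimp (Mor.id _) sign) (tt _)
    (by simp [band_comp, bimp, bneg]) (by
      have := band_succ_left (E := E) (Mor.id _) (ff _)
      simp only [comp_id] at this
      simp [band_comp, bimp, bneg, sign_succ', this]) p
  simpa [bimp_comp] using h

theorem entails_iff {A : Ob} {p q : Mor E A Ob.nat} : Entails p q ↔ band p q = sign ⊚ p := by
  constructor
  · intro h
    rw [← band_bimp, show bimp p q = tt A from h, band_tt]
  · intro h
    rw [Entails, ← bimp_band, h, bimp_sign_self]

namespace Entails

theorem rfl' {A : Ob} (p : Mor E A Ob.nat) : Entails p p := entails_iff.2 (band_self p)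

theorem trans {A : Ob} {p q r : Mor E A Ob.nat} (h₁ : Entails p q) (h₂ : Entails q r) :
    Entails p r := by
  rw [entails_iff] at *
  rw [← band_sign_left, ← h₁, band_assoc, h₂, band_sign_right]

theorem left {A : Ob} (p q : Mor E A Ob.nat) : Entails (band p q) p := by
  rw [entails_iff, band_comm, ← band_assoc, band_self, band_sign_left, sign_band]

theorem right {A : Ob} (p q : Mor E A Ob.nat) : Entails (band p q) q := by
  rw [band_comm]; exact left q p

theorem and {A : Ob} {c p q : Mor E A Ob.nat} (h₁ : Entails c p) (h₂ : Entails c q) :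
    Entails c (band p q) := by
  rw [entails_iff] at *
  rw [← band_assoc, h₁, band_sign_left, h₂]

theorem true {A : Ob} (p : Mor E A Ob.nat) : Entails p (tt A) := entails_iff.2 (band_tt p)

theorem subst {A C : Ob} {p q : Mor E A Ob.nat} (h : Entails p q) (t : Mor E C A) :
    Entails (p ⊚ t) (q ⊚ t) := by
  rw [Entails, ← bimp_comp, show bimp p q = tt A from h, tt_comp]

theorem mp {A : Ob} {c p q : Mor E A Ob.nat} (h₁ : Entails c (bimp p q)) (h₂ : Entails c p) :
    Entails c q := by
  have h := h₂.and h₁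
  rw [band_bimp] at h
  exact h.trans (right p q)

theorem curry {A : Ob} {c p q : Mor E A Ob.nat} (h : Entails (band c p) q) :
    Entails c (bimp p q) := by
  have key : band c (bimp p q) = band c (bimp (band c p) q) := by
    have h := cases_elt (E := E) (A := Ob.prod Ob.nat Ob.nat)
      (band snd (bimp (fst ⊚ fst) (snd ⊚ fst)))
      (band snd (bimp (band snd (fst ⊚ fst)) (snd ⊚ fst)))
      (by simp [band_comp]) (by
        simp only [band_comp, bimp_comp, assoc, snd_pair, fst_pair, band_succ_left]
        simp only [bimp, band_sign_left]) (pair p q) c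
    simpa [band_comp, bimp_comp] using h
  rw [entails_iff, key, show bimp (band c p) q = tt A from h, band_tt]

/-- An invariant of the step map is an invariant of the iterated. -/
theorem iter {A : Ob} {p : Mor E A Ob.nat} {f : Mor E A A} (h : Entails p (p ⊚ f)) :
    Entails (p ⊚ fst) (p ⊚ Mor.iter f) := by
  let r : Mor E (Ob.prod A Ob.nat) Ob.nat :=
    prr (sign ⊚ p) (band snd (p ⊚ f ⊚ Mor.iter f ⊚ fst))
  have r_zero : r ⊚ pair (Mor.id A) (zero ⊚ bang A) = sign ⊚ p := by simp [r]
  have r_succ : r ⊚ pair fst (succ ⊚ snd) = band r (p ⊚ f ⊚ Mor.iter f) := by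
    simp [r, band_comp]
  have hr : Entails r (p ⊚ Mor.iter f) := by
    rw [entails_iff]
    apply cases_ext
    · have h₁ : Mor.iter f ⊚ pair (Mor.id A) (zero ⊚ bang A) = Mor.id A := by simp
      rw [band_comp, assoc, assoc, r_zero, h₁, comp_id, band_sign_left, band_self, sign_sign]
    · have h₁ : Mor.iter f ⊚ pair fst (succ ⊚ snd) = f ⊚ Mor.iter f := by simp
      rw [band_comp, assoc, assoc, r_succ, h₁, band_assoc, band_self, band_sign_right, sign_band]
  have hs : Entails r (p ⊚ f ⊚ Mor.iter f) :=
    hr.trans (by simpa using h.subst (Mor.iter f))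
  have hc : sign ⊚ r = sign ⊚ p ⊚ fst := by
    apply freyd_ext (Mor.id _)
    · rw [assoc, r_zero]; simp
    · rw [assoc, r_succ, sign_band, entails_iff.1 hs, id_comp]
    · simp
  have : Entails (p ⊚ fst) r := by
    rw [entails_iff, ← band_sign_right, hc, band_sign_right, band_self]
  exact this.trans hr

end Entails

theorem ofPred_ok {A : Ob} {p : Mor E A Ob.nat} (hp : sign ⊚ p = p) :
    blt p (succ ⊚ tt A) = tt A := by
  have h := cases_elt' (E := E) (blt sign (succ ⊚ tt _)) (tt _)
    (by
      have h₀ : ∀ x : Mor E Ob.one Ob.nat, sub ⊚ pair x (ff _) = x := fun x => by simp [sub, ff]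
      simp [blt, h₀]) (by
      have h₁ : pre ⊚ succ ⊚ tt Ob.nat = (tt _ : Mor E _ _) := pre_succ _
      have h₂ : ∀ x : Mor E Ob.nat Ob.nat, sub ⊚ pair x (tt _) = pre ⊚ x := fun x => by
        rw [← succ_ff, sub, iter_succ]; simp [ff]
      simp [blt, sign_succ', h₂, h₁]) p
  simpa [blt, hp] using h

end Mor

/-! ## The theory `S = (PR + E) + (abstr)` with predicate abstraction

For `E` empty this is the theory `PR_A`. -/

/-- Objects `{A | χ}`: predicates `χ`, that is `sign ∘ χ = χ`, on fundamental objects. -/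
structure Obj (E : Eqns) : Type where
  base : Ob
  pred : Mor E base Ob.nat
  isPred : sign ⊚ pred = pred

namespace Obj

/-- A fundamental object `{A | true}`. -/
abbrev fund (A : Ob) : Obj E := ⟨A, tt A, sign_tt⟩

/-- The object `ℕ`. -/
abbrev nat : Obj E := fund Ob.nat

/-- The object `2 = {n ∈ ℕ | n < s s 0}`. -/
abbrev two : Obj E := ⟨Ob.nat, blt (Mor.id _) (succ ⊚ tt _), by simp [blt]⟩

/-- The Cartesian product of objects. -/
abbrev prod (A B : Obj E) : Obj E :=
  ⟨Ob.prod A.base B.base, band (A.pred ⊚ fst) (B.pred ⊚ snd), sign_band _ _⟩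

/-- The extension `{A | p}` of a predicate on an object. -/
abbrev ext (A : Obj E) (p : Mor E A.base Ob.nat) : Obj E :=
  ⟨A.base, band A.pred p, sign_band _ _⟩

end Obj

/-- Map terms of `S` from `{A | χ}` to `{B | ψ}`: maps `A → B` that transform `χ` into `ψ`. -/
structure SMap (A B : Obj E) : Type where
  tm : Mor E A.base B.base
  ok : Entails A.pred (B.pred ⊚ tm)

namespace SMap

/-- Equality `f = g` of maps in the theory `S`: agreement on the predicate of the domain. -/
def Eq {A B : Obj E} (f g : SMap A B) : Prop := Entails A.pred (beq f.tm g.tm)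

def id (A : Obj E) : SMap A A := ⟨Mor.id _, by simpa using Entails.rfl' A.pred⟩

def comp {A B C : Obj E} (g : SMap B C) (f : SMap A B) : SMap A C :=
  ⟨g.tm ⊚ f.tm, f.ok.trans (by simpa using g.ok.subst f.tm)⟩

def fst {A B : Obj E} : SMap (A.prod B) A := ⟨Mor.fst, Entails.left _ _⟩

def snd {A B : Obj E} : SMap (A.prod B) B := ⟨Mor.snd, Entails.right _ _⟩

def pair {C A B : Obj E} (f : SMap C A) (g : SMap C B) : SMap C (A.prod B) :=
  ⟨Mor.pair f.tm g.tm, by simpa [Obj.prod, band_comp] using f.ok.and g.ok⟩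

/-- The inclusion `{A | p} ⊆ A`. -/
def incl {A : Obj E} (p : Mor E A.base Ob.nat) : SMap (A.ext p) A :=
  ⟨Mor.id _, by rw [comp_id]; exact Entails.left A.pred p⟩

/-- The constant map `0`. -/
def zero (A : Obj E) : SMap A Obj.nat :=
  ⟨ff _, by simpa [Obj.nat, Obj.fund] using Entails.true A.pred⟩

/-- A map into `ℕ` given by a map of fundamental objects. -/
def ofNat {A : Obj E} (t : Mor E A.base Ob.nat) : SMap A Obj.nat :=
  ⟨t, by simpa [Obj.nat, Obj.fund] using Entails.true A.pred⟩

/-- A predicate as a map into `2`. -/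
def ofPred {A : Obj E} (p : Mor E A.base Ob.nat) (hp : sign ⊚ p = p) : SMap A Obj.two :=
  ⟨p, by
    have h := ofPred_ok hp
    have h' : (blt (Mor.id _) (succ ⊚ tt _) ⊚ p : Mor E A.base Ob.nat) = tt _ := by
      simpa [blt] using h
    simpa [Obj.two, h'] using Entails.true A.pred⟩

/-- Negation `¬ : 2 → 2`. -/
def not : SMap (E := E) Obj.two Obj.two :=
  ofPred neg (by simpa using sign_neg (E := E) (Mor.id Ob.nat))

/-- The iterated `f^§ : A × ℕ → A`. -/
def iter {A : Obj E} (f : SMap A A) : SMap (A.prod Obj.nat) A :=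
  ⟨Mor.iter f.tm, (Entails.left _ _).trans f.ok.iter⟩

end SMap

/-! ## Relations and partial maps over `S` -/

/-- A graph `(d, rule) : D → A × B` in `S`; without right uniqueness it is only a relation. -/
structure Rel (A B : Obj E) : Type where
  D : Obj E
  d : SMap D A
  rule : SMap D B

namespace Rel

/-- Right uniqueness, `d x ≐ d x' ⟹ rule x ≐ rule x'` for `x, x'` free in `D`: the relation is
a partial map `A ⇀ B`, a map of the theory `Ŝ`. -/
def IsPartial {A B : Obj E} (f : Rel A B) : Prop :=
  Entails (f.D.prod f.D).pred
    (bimp (beq (f.d.tm ⊚ Mor.fst) (f.d.tm ⊚ Mor.snd))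
      (beq (f.rule.tm ⊚ Mor.fst) (f.rule.tm ⊚ Mor.snd)))

/-- Inclusion of graphs, by a comparison map that is compatible with both components. -/
def Incl {A B : Obj E} (f g : Rel A B) : Prop :=
  ∃ i : SMap f.D g.D, (g.d.comp i).Eq f.d ∧ (g.rule.comp i).Eq f.rule

/-- Partial equality `f ≐ g`: availability of comparison maps in both directions. -/
def PEq {A B : Obj E} (f g : Rel A B) : Prop := f.Incl g ∧ g.Incl f

/-- The embedding of `S`. -/
def emb {A B : Obj E} (f : SMap A B) : Rel A B := ⟨A, SMap.id A, f⟩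

/-- A map on a decidable part `{A | γ}` of `A`, seen as a defined partial map on `A`. -/
def restr {A B : Obj E} (γ : SMap A Obj.two) (q : SMap (A.ext γ.tm) B) : Rel A B :=
  ⟨A.ext γ.tm, SMap.incl γ.tm, q⟩

/-- The pullback of two maps with common codomain, and its projections. -/
def pb {A B C : Obj E} (f : SMap A C) (g : SMap B C) : Obj E :=
  (A.prod B).ext (beq (f.tm ⊚ Mor.fst) (g.tm ⊚ Mor.snd))

def pbl {A B C : Obj E} (f : SMap A C) (g : SMap B C) : SMap (pb f g) A :=
  SMap.fst.comp (SMap.incl _)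

def pbr {A B C : Obj E} (f : SMap A C) (g : SMap B C) : SMap (pb f g) B :=
  SMap.snd.comp (SMap.incl _)

/-- Composition, by pullback of the rule of `f` and the defined arguments of `g`. -/
def comp {A B C : Obj E} (g : Rel B C) (f : Rel A B) : Rel A C :=
  ⟨pb f.rule g.d, f.d.comp (pbl _ _), g.rule.comp (pbr _ _)⟩

/-- The monoidal product `f × g`. -/
def prod {A B A' B' : Obj E} (f : Rel A B) (g : Rel A' B') : Rel (A.prod A') (B.prod B') :=
  ⟨f.D.prod g.D, (f.d.comp SMap.fst).pair (g.d.comp SMap.snd),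
    (f.rule.comp SMap.fst).pair (g.rule.comp SMap.snd)⟩

/-! ### The `μ`-operator on predicates of `S` and the `μ`-representation of a partial map -/

/-- `μ φ : A ⇀ ℕ`, with defined arguments `(a, n) ↦ a` on `{A × ℕ | φ}` and with rule
`(a, n) ↦ min {m ≤ n | φ (a, m)}`. -/
def mu {A : Obj E} (φ : SMap (A.prod Obj.nat) Obj.two) : Rel A Obj.nat :=
  ⟨(A.prod Obj.nat).ext φ.tm, SMap.fst.comp (SMap.incl φ.tm), SMap.ofNat (bmin φ.tm)⟩

/-- For `f = (d, rule)` with `D_f = {D | δ}`, the predicate `φ_f : A × ℕ → 2` which says that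
`cnt_D n` is in `D_f` and `a ≐ d (cnt_D n)`. -/
def phi {A B : Obj E} (f : Rel A B) : SMap (A.prod Obj.nat) Obj.two :=
  SMap.ofPred (A := A.prod Obj.nat)
    (band (f.D.pred ⊚ cnt f.D.base ⊚ Mor.snd)
      (beq Mor.fst (f.d.tm ⊚ cnt f.D.base ⊚ Mor.snd))) (sign_band _ _)

/-- The map `rule ∘ cnt_D`, seen as a defined partial map `ℕ ⇀ B`: it is defined at those `n`
for which `cnt_D n` is in `D_f`. -/
def cntRule {A B : Obj E} (f : Rel A B) : Rel Obj.nat B :=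
  restr (SMap.ofPred (A := Obj.nat) (f.D.pred ⊚ cnt f.D.base) (by
      have h := congrArg (fun k => k ⊚ cnt f.D.base) f.D.isPred
      simpa using h))
    ⟨f.rule.tm ⊚ cnt f.D.base,
      (Entails.right _ _).trans (by
        have h := f.rule.ok.subst (cnt f.D.base)
        rw [assoc] at h
        exact h)⟩

/-! ### Iteration, `μ`-operator and `while` loops for partial maps -/

/-- One step of the iteration of `f : A ⇀ A` on states `((a, w), c)`. Here `w` codes (via `cantor`)
a sequence of numbers, hence (via `cnt`) of elements `x` of the domain of `d`, and `c` tells whether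
all steps so far were correct: `(a, w)` goes to `(rule x, w')` for `x` the first entry
of `w` and `w'` the rest, and this is correct if `x` is in `D_f` and `d x ≐ a`. -/
def step {A : Obj E} (f : Rel A A) :
    Mor E (Ob.prod (Ob.prod A.base Ob.nat) Ob.nat) (Ob.prod (Ob.prod A.base Ob.nat) Ob.nat) :=
  let c := cantor ⊚ Mor.snd ⊚ Mor.fst
  let x := cnt f.D.base ⊚ Mor.fst ⊚ c
  Mor.pair (Mor.pair (f.rule.tm ⊚ x) (Mor.snd ⊚ c))
    (band Mor.snd (band (f.D.pred ⊚ x) (beq (f.d.tm ⊚ x) (Mor.fst ⊚ Mor.fst))))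

/-- The state after `n` steps from `((a, w), true)`, as a map of `((a, n), w)`. -/
def run {A : Obj E} (f : Rel A A) :
    Mor E (Ob.prod (Ob.prod A.base Ob.nat) Ob.nat) (Ob.prod (Ob.prod A.base Ob.nat) Ob.nat) :=
  Mor.iter f.step ⊚
    Mor.pair (Mor.pair (Mor.pair (Mor.fst ⊚ Mor.fst) Mor.snd) (tt _)) (Mor.snd ⊚ Mor.fst)

theorem step_ok {A : Obj E} (f : Rel A A) :
    let p := bimp (Mor.snd : Mor E (Ob.prod (Ob.prod A.base Ob.nat) Ob.nat) Ob.nat)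
      (A.pred ⊚ Mor.fst ⊚ Mor.fst)
    Entails p (p ⊚ f.step) := by
  intro p
  simp only [p, bimp_comp, step, assoc, snd_pair, fst_pair]
  apply Entails.curry
  refine (Entails.right _ _).trans ((Entails.right _ _).trans ((Entails.left _ _).trans ?_))
  simpa using f.rule.ok.subst _

theorem run_ok {A : Obj E} (f : Rel A A) :
    Entails (((A.prod Obj.nat).prod Obj.nat).ext (Mor.snd ⊚ f.run)).pred
      (A.pred ⊚ Mor.fst ⊚ Mor.fst ⊚ f.run) := by
  have h := f.step_ok.iter.subst
    (Mor.pair (Mor.pair (Mor.pair (Mor.fst ⊚ Mor.fst) Mor.snd) (tt _)) (Mor.snd ⊚ Mor.fst) :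
      Mor E (Ob.prod (Ob.prod A.base Ob.nat) Ob.nat) _)
  simp only [assoc, bimp_comp, fst_pair, snd_pair] at h
  refine Entails.mp (p := Mor.snd ⊚ f.run) ?_ (Entails.right _ _)
  refine Entails.trans ?_ h
  apply Entails.curry
  refine (Entails.left _ _).trans ((Entails.left _ _).trans ((Entails.left _ _).trans ?_))
  simp only [band_comp, assoc]
  exact Entails.left _ _

/-- Iteration `f^§ : A × ℕ ⇀ A` of a partial map `f : A ⇀ A`: it is defined at `(a, n)` by
those `w` for which all of the `n` steps are correct. -/
def iter {A : Obj E} (f : Rel A A) : Rel (A.prod Obj.nat) A :=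
  ⟨((A.prod Obj.nat).prod Obj.nat).ext (Mor.snd ⊚ f.run), SMap.fst.comp (SMap.incl _),
    ⟨Mor.fst ⊚ Mor.fst ⊚ f.run, by simpa using f.run_ok⟩⟩

/-- For a partial predicate `φ : A × ℕ ⇀ 2`, the partial map `(a, n) ↦ (a, s n)` defined at those
`(a, n)` for which `φ (a, n)` is defined and false. -/
def next {A : Obj E} (φ : Rel (A.prod Obj.nat) Obj.two) : Rel (A.prod Obj.nat) (A.prod Obj.nat) :=
  ⟨φ.D.ext (bneg φ.rule.tm), φ.d.comp (SMap.incl _),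
    (SMap.fst.pair (SMap.ofNat (succ ⊚ Mor.snd))).comp (φ.d.comp (SMap.incl _))⟩

/-- The partial map `(a, n) ↦ n` defined at those `(a, n)` for which `φ (a, n)` is defined and
true. -/
def found {A : Obj E} (φ : Rel (A.prod Obj.nat) Obj.two) : Rel (A.prod Obj.nat) Obj.nat :=
  ⟨φ.D.ext φ.rule.tm, φ.d.comp (SMap.incl _), SMap.snd.comp (φ.d.comp (SMap.incl _))⟩

/-- The partial map `(a, n) ↦ n` defined at those `(a, n)` for which `φ (a, n)` is defined
and true while `φ (a, m)` is defined and false for all `m < n`. -/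
def least {A : Obj E} (φ : Rel (A.prod Obj.nat) Obj.two) : Rel (A.prod Obj.nat) Obj.nat :=
  φ.found.comp (φ.next.iter.comp
    (emb ((SMap.fst.pair (SMap.zero (A.prod Obj.nat))).pair SMap.snd)))

/-- The `μ`-operator on partial predicates `φ : A × ℕ ⇀ 2`: `μ φ (a) = n` if `φ (a, n)` is true
and `φ (a, m)` is defined and false for all `m < n`. -/
def muHat {A : Obj E} (φ : Rel (A.prod Obj.nat) Obj.two) : Rel A Obj.nat :=
  ⟨φ.least.D, SMap.fst.comp φ.least.d, φ.least.rule⟩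

/-- The loop `while χ do f` for maps `χ : A → 2` and `f : A → A` of `S`: it is
`f^§ ∘ (A × μ φ) ∘ Δ` with `φ (a, n) = ¬ χ (f^n (a))`. -/
def wh {A : Obj E} (χ : SMap A Obj.two) (f : SMap A A) : Rel A A :=
  (emb f.iter).comp (((emb (SMap.id A)).prod (mu (SMap.not.comp (χ.comp f.iter)))).comp
    (emb ((SMap.id A).pair (SMap.id A))))

/-- The loop `while χ do f` for partial `χ : A ⇀ 2` and `f : A ⇀ A`, by the same formula. -/
def whHat {A : Obj E} (χ : Rel A Obj.two) (f : Rel A A) : Rel A A :=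
  f.iter.comp (((emb (SMap.id A)).prod (muHat ((emb SMap.not).comp (χ.comp f.iter)))).comp
    (emb ((SMap.id A).pair (SMap.id A))))

end Rel

/-! ## The theories `Ŝ`, `μS`, `μμS`, … and the theories of `while` programs -/

/-- A class of relations. -/
abbrev RelClass (E : Eqns) : Type := ∀ ⦃A B : Obj E⦄, Rel A B → Prop

/-- The maps of the theory `Ŝ` of partial maps over `S`. -/
def Hat (E : Eqns) : RelClass E := fun _ _ f => f.IsPartial

/-- `MuRec E k`: `μ`-recursive maps over `S` of level at most `k`. They are generated from the
(defined partial) maps of `S` by composition, product, iteration, and by the `μ`-operator with at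
most `k` nested uses. Level `1`, where `μ` is applied to predicates of `S` only, is the
theory `μS`; level `2`, where `μ` is applied to predicates of `μS`, is `μμS`; and so on. -/
inductive MuRec (E : Eqns) : ℕ → RelClass E
  | emb (k : ℕ) {A B : Obj E} (f : SMap A B) : MuRec E k (Rel.emb f)
  | restr (k : ℕ) {A B : Obj E} (γ : SMap A Obj.two) (q : SMap (A.ext γ.tm) B) :
      MuRec E k (Rel.restr γ q)
  | comp (k : ℕ) {A B C : Obj E} (g : Rel B C) (f : Rel A B) (hg : MuRec E k g)
      (hf : MuRec E k f) : MuRec E k (g.comp f)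
  | prod (k : ℕ) {A B A' B' : Obj E} (f : Rel A B) (g : Rel A' B') (hf : MuRec E k f)
      (hg : MuRec E k g) : MuRec E k (f.prod g)
  | iter (k : ℕ) {A : Obj E} (f : Rel A A) (hf : MuRec E k f) : MuRec E k f.iter
  | mu (k : ℕ) {A : Obj E} (φ : SMap (A.prod Obj.nat) Obj.two) : MuRec E (k + 1) (Rel.mu φ)
  | muHat (k : ℕ) {A : Obj E} (φ : Rel (A.prod Obj.nat) Obj.two) (hφ : MuRec E (k + 1) φ) :
      MuRec E (k + 2) φ.muHat

/-- `WhileRec E k`: maps given by `while` programs over `S` with nesting depth of loops at most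
`k`. At depth `1` control and body of the loops are maps of `S`, at depth `k + 2` they are
given by programs of depth `k + 1`. -/
inductive WhileRec (E : Eqns) : ℕ → RelClass E
  | emb (k : ℕ) {A B : Obj E} (f : SMap A B) : WhileRec E k (Rel.emb f)
  | restr (k : ℕ) {A B : Obj E} (γ : SMap A Obj.two) (q : SMap (A.ext γ.tm) B) :
      WhileRec E k (Rel.restr γ q)
  | comp (k : ℕ) {A B C : Obj E} (g : Rel B C) (f : Rel A B) (hg : WhileRec E k g)
      (hf : WhileRec E k f) : WhileRec E k (g.comp f)
  | prod (k : ℕ) {A B A' B' : Obj E} (f : Rel A B) (g : Rel A' B') (hf : WhileRec E k f)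
      (hg : WhileRec E k g) : WhileRec E k (f.prod g)
  | wh (k : ℕ) {A : Obj E} (χ : SMap A Obj.two) (f : SMap A A) : WhileRec E (k + 1) (Rel.wh χ f)
  | whHat (k : ℕ) {A : Obj E} (χ : Rel A Obj.two) (f : Rel A A) (hχ : WhileRec E (k + 1) χ)
      (hf : WhileRec E (k + 1) f) : WhileRec E (k + 2) (Rel.whHat χ f)

/-- `f` is a (defined partial) map of `S` after `μ φ` for a single predicate `φ` of `S`. -/
def OneMu {A B : Obj E} (f : Rel A B) : Prop :=
  ∃ (φ : SMap (A.prod Obj.nat) Obj.two) (γ : SMap Obj.nat Obj.two)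
    (q : SMap (Obj.nat.ext γ.tm) B), f.PEq ((Rel.restr γ q).comp (Rel.mu φ))

/-- `f` is given by a single `while` loop with control and body in `S`, preceded by a map of `S` and
followed by a (defined partial) map `q` of `S`; if the underlying map of `q`
is total as a map of `S`, this total map may be taken. -/
def OneWhile {A B : Obj E} (f : Rel A B) : Prop :=
  ∃ (C : Obj E) (p : SMap A C) (χ : SMap C Obj.two) (g : SMap C C) (γ : SMap C Obj.two)
    (q : SMap (C.ext γ.tm) B),
    f.PEq ((Rel.restr γ q).comp ((Rel.wh χ g).comp (Rel.emb p))) ∧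
    ∀ q' : SMap C B, q'.tm = q.tm → f.PEq ((Rel.emb q').comp ((Rel.wh χ g).comp (Rel.emb p)))

/-- The class `K` of relations is, up to partial equality, a category with the objects of `S`. -/
structure Lawful (K : RelClass E) : Prop where
  id_mem (A : Obj E) : K (Rel.emb (SMap.id A))
  comp_mem {A B C : Obj E} {g : Rel B C} {f : Rel A B} : K g → K f → K (g.comp f)
  refl {A B : Obj E} {f : Rel A B} : K f → f.PEq f
  symm {A B : Obj E} {f g : Rel A B} : K f → K g → f.PEq g → g.PEq f
  trans {A B : Obj E} {f g h : Rel A B} : K f → K g → K h → f.PEq g → g.PEq h → f.PEq h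
  comp_congr {A B C : Obj E} {g g' : Rel B C} {f f' : Rel A B} :
    K g → K g' → K f → K f' → g.PEq g' → f.PEq f' → (g.comp f).PEq (g'.comp f')
  id_comp {A B : Obj E} {f : Rel A B} : K f → ((Rel.emb (SMap.id B)).comp f).PEq f
  comp_id {A B : Obj E} {f : Rel A B} : K f → (f.comp (Rel.emb (SMap.id A))).PEq f
  assoc {A B C D : Obj E} {h : Rel C D} {g : Rel B C} {f : Rel A B} :
    K h → K g → K f → ((h.comp g).comp f).PEq (h.comp (g.comp f))

/-- The objects of the theory with maps in `K`. -/
def Th (K : RelClass E) (_ : Lawful K) : Type := Obj E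

/-- Partial equality on the maps in `K`. -/
def homSetoid (K : RelClass E) (h : Lawful K) (A B : Obj E) : Setoid {f : Rel A B // K f} where
  r f g := f.1.PEq g.1
  iseqv := ⟨fun f => h.refl f.2, fun {f g} => h.symm f.2 g.2,
    fun {f g k} => h.trans f.2 g.2 k.2⟩

/-- The theory with maps in `K` as a category: maps are taken up to partial equality. -/
instance thCategory (K : RelClass E) (h : Lawful K) : Category (Th K h) where
  Hom A B := Quotient (homSetoid K h A B)
  id A := Quotient.mk (homSetoid K h A A) ⟨Rel.emb (SMap.id A), h.id_mem A⟩
  comp {A B C} f g := Quotient.map₂ (sa := homSetoid K h A B) (sb := homSetoid K h B C)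
    (sc := homSetoid K h A C) (fun f g => ⟨g.1.comp f.1, h.comp_mem g.2 f.2⟩)
    (fun f f' hf g g' hg => h.comp_congr g.2 g'.2 f.2 f'.2 hg hf) f g
  id_comp {A B} f := by
    induction f using Quotient.ind with | _ f => exact Quotient.sound (h.comp_id f.2)
  comp_id {A B} f := by
    induction f using Quotient.ind with | _ f => exact Quotient.sound (h.id_comp f.2)
  assoc {A B C D} f g k := by
    induction f using Quotient.ind with | _ f =>
    induction g using Quotient.ind with | _ g =>
    induction k using Quotient.ind with | _ k =>
    exact Quotient.sound (h.symm (h.comp_mem (h.comp_mem k.2 g.2) f.2)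
      (h.comp_mem k.2 (h.comp_mem g.2 f.2)) (h.assoc k.2 g.2 f.2))

/-- The inclusion of theories with the same objects: it sends each map to itself. -/
def inclusion {K L : RelClass E} (hK : Lawful K) (hL : Lawful L)
    (hKL : ∀ ⦃A B : Obj E⦄ (f : Rel A B), K f → L f) : Th K hK ⥤ Th L hL where
  obj A := A
  map {A B} f := Quotient.map (sa := homSetoid K hK A B) (sb := homSetoid L hL A B)
    (fun f => ⟨f.1, hKL f.1 f.2⟩) (fun _ _ h => h) f
  map_id _ := rfl
  map_comp {A B C} f g := by
    induction f using Quotient.ind with | _ f =>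
    induction g using Quotient.ind with | _ g => rfl

/-- The inclusion of the theory `K` into the theory `L` exists and is an equivalence. -/
def InclusionEquiv (K L : RelClass E) : Prop :=
  ∃ (hK : Lawful K) (hL : Lawful L) (hKL : ∀ ⦃A B : Obj E⦄ (f : Rel A B), K f → L f),
    (inclusion hK hL hKL).IsEquivalence

end PRM

namespace PRM

open CategoryTheory Mor

variable {E : Eqns}

/-! ## Case distinction and conditional equality -/

namespace Mor

/-! Right uniqueness is the only property of a partial map that the normal forms need. The Cantor
count reaches every witness of `f`, so a search for the least `n` with `φ_f (a, n)` finds some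
witness over `a` whenever there is one, and right uniqueness makes the rule at that witness the
value of `f`. Hence a class of partial maps that contains the maps of `S`, is closed under
composition and has a single `μ` on predicates of `S` (or a single loop that counts up to the least
index) already represents all of `Ŝ`. Objects and equality are the same in both theories, so the
inclusion is an equivalence. About `μ`, iteration and loops it only remains to show that they
preserve right uniqueness.

All claims are about derivability in `PR + E`, and partial equality asks for comparison maps in `S`.
Formal derivations are replaced by reasoning with elements in models: a model is an ultrafilter of
predicates on a context, and its elements are maps out of the context, identified when they agree on
a member of the ultrafilter. Truth is two-valued there, and every number is zero or a successor. By
`eq_of_ev` and `entails_iff_ev`, validity in all models is derivability. By `exists_mor`, an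
existence statement valid in all models is witnessed by one map. So `pEq_iff` and `isPartial_iff`
turn partial equality into equality of graphs in all models, and right uniqueness into
single-valuedness.

The numbers of a model may be nonstandard, so `induction` applies only to predicates given by maps.
This is why inductive statements below are first encoded as such a predicate, often called `p`. The
arithmetic needed is that `beq` means equality of values (`T_beq`) and that the count is onto
(`cnt_surjective`). -/

theorem ite_comp {A B C : Ob} (c : Mor E A Ob.nat) (x y : Mor E A B) (t : Mor E C A) :
    Mor.ite c x y ⊚ t = Mor.ite (c ⊚ t) (x ⊚ t) (y ⊚ t) := by simp [Mor.ite]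

@[simp] theorem ite_ff {A B : Ob} (x y : Mor E A B) : Mor.ite (ff A) x y = y := by
  simp [Mor.ite, ff]

@[simp] theorem ite_succ {A B : Ob} (n : Mor E A Ob.nat) (x y : Mor E A B) :
    Mor.ite (succ ⊚ n) x y = x := by
  simp [Mor.ite]

@[simp] theorem ite_tt {A B : Ob} (x y : Mor E A B) : Mor.ite (tt A) x y = x := by
  rw [← succ_ff, ite_succ]

theorem comp_ite {A B C : Ob} (h : Mor E B C) (c : Mor E A Ob.nat) (x y : Mor E A B) :
    h ⊚ Mor.ite c x y = Mor.ite c (h ⊚ x) (h ⊚ y) := by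
  have := cases_elt (h ⊚ Mor.ite snd (x ⊚ fst) (y ⊚ fst))
    (Mor.ite snd (h ⊚ x ⊚ fst) (h ⊚ y ⊚ fst)) (by simp [ite_comp]) (by simp [ite_comp])
    (Mor.id _) c
  simpa [ite_comp] using this

theorem ite_pair {A B C : Ob} (c : Mor E A Ob.nat) (x y : Mor E A B) (x' y' : Mor E A C) :
    Mor.ite c (pair x x') (pair y y') = pair (Mor.ite c x y) (Mor.ite c x' y') := by
  rw [← pair_eta (Mor.ite c (pair x x') (pair y y')), comp_ite, comp_ite]
  simp

@[simp] theorem ite_self {A B : Ob} (c : Mor E A Ob.nat) (x : Mor E A B) :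
    Mor.ite c x x = x := by
  have := cases_elt (Mor.ite snd (x ⊚ fst) (x ⊚ fst))
    (x ⊚ fst) (by simp [ite_comp]) (by simp [ite_comp]) (Mor.id _) c
  simpa [ite_comp] using this

theorem ite_ite_left {A B : Ob} (c : Mor E A Ob.nat) (x y z : Mor E A B) :
    Mor.ite c (Mor.ite c x y) z = Mor.ite c x z := by
  have := cases_elt (Mor.ite snd (Mor.ite snd (x ⊚ fst) (y ⊚ fst)) (z ⊚ fst))
    (Mor.ite snd (x ⊚ fst) (z ⊚ fst)) (by simp [ite_comp]) (by simp [ite_comp]) (Mor.id _) c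
  simpa [ite_comp] using this

theorem ite_sign {A B : Ob} (c : Mor E A Ob.nat) (x y : Mor E A B) :
    Mor.ite (sign ⊚ c) x y = Mor.ite c x y := by
  have := cases_elt (Mor.ite (sign ⊚ snd) (x ⊚ fst) (y ⊚ fst))
    (Mor.ite snd (x ⊚ fst) (y ⊚ fst)) (by simp [ite_comp]) (by simp [ite_comp]) (Mor.id _) c
  simpa [ite_comp] using this

theorem ite_band {A B : Ob} (c c' : Mor E A Ob.nat) (x y : Mor E A B) :
    Mor.ite (band c c') x y = Mor.ite c (Mor.ite c' x y) y := by
  have := cases_elt (Mor.ite (band snd (c' ⊚ fst)) (x ⊚ fst) (y ⊚ fst))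
    (Mor.ite snd (Mor.ite (c' ⊚ fst) (x ⊚ fst) (y ⊚ fst)) (y ⊚ fst))
    (by simp [ite_comp, band_comp]) (by simp [ite_comp, band_comp, ite_sign]) (Mor.id _) c
  simpa [ite_comp, band_comp] using this

/-- Splits a condition along a second one, so that conditional equalities can be glued in
`CEq.cases`. -/
theorem ite_cases {A B : Ob} (c c' : Mor E A Ob.nat) (x y : Mor E A B) :
    Mor.ite c x y =
      Mor.ite c' (Mor.ite (band c c') x y) (Mor.ite (band c (bneg c')) x y) := by
  have := cases_elt (Mor.ite (c ⊚ fst) (x ⊚ fst) (y ⊚ fst))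
    (Mor.ite snd (Mor.ite (band (c ⊚ fst) snd) (x ⊚ fst) (y ⊚ fst))
      (Mor.ite (band (c ⊚ fst) (bneg snd)) (x ⊚ fst) (y ⊚ fst)))
    (by simp [ite_comp, band_comp, bneg, ite_sign])
    (by simp [ite_comp, band_comp, bneg_comp, band_succ_right, ite_sign]) (Mor.id _) c'
  simpa [ite_comp, band_comp, bneg_comp] using this

/-- Equality of `f` and `g` under the condition `p`. -/
def CEq {A B : Ob} (p : Mor E A Ob.nat) (f g : Mor E A B) : Prop := Mor.ite p f g = g

namespace CEq

theorem refl {A B : Ob} (p : Mor E A Ob.nat) (f : Mor E A B) : CEq p f f := ite_self _ _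

theorem symm {A B : Ob} {p : Mor E A Ob.nat} {f g : Mor E A B} (h : CEq p f g) : CEq p g f := by
  unfold CEq at *
  rw [← h, ite_ite_left, ite_self]

theorem trans {A B : Ob} {p : Mor E A Ob.nat} {f g k : Mor E A B} (h : CEq p f g)
    (h' : CEq p g k) : CEq p f k := by
  unfold CEq at *
  rw [← ite_ite_left p f g, h, h']

/-- Up to `sign`, the stronger condition is its own conjunction with the weaker one. With `cases`,
this makes the conditions under which two maps agree an ideal to which `exists_model` applies. -/
theorem mono {A B : Ob} {p q : Mor E A Ob.nat} {f g : Mor E A B} (hqp : Entails q p)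
    (h : CEq p f g) : CEq q f g := by
  unfold CEq at *
  rw [← ite_sign, ← entails_iff.1 hqp, ite_band, h, ite_self]

theorem cases {A B : Ob} {p q : Mor E A Ob.nat} {f g : Mor E A B} (h : CEq (band q p) f g)
    (h' : CEq (band q (bneg p)) f g) : CEq q f g := by
  unfold CEq at *
  rw [ite_cases q p, h, h', ite_self]

theorem comp {A B C : Ob} {p : Mor E A Ob.nat} {f g : Mor E A B} (k : Mor E B C)
    (h : CEq p f g) : CEq p (k ⊚ f) (k ⊚ g) := by
  unfold CEq at *
  rw [← comp_ite, h]

theorem pair {A B C : Ob} {p : Mor E A Ob.nat} {f g : Mor E A B} {f' g' : Mor E A C}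
    (h : CEq p f g) (h' : CEq p f' g') : CEq p (Mor.pair f f') (Mor.pair g g') := by
  unfold CEq at *
  rw [ite_pair, h, h']

end CEq

end Mor

/-! ## Ultrafilter models -/

/-- A model: a context with an ultrafilter of predicates on it. -/
structure Model (E : Eqns) : Type where
  ctx : Ob
  F : Set (Mor E ctx Ob.nat)
  tt_mem : tt ctx ∈ F
  band_mem : ∀ p ∈ F, ∀ q ∈ F, band p q ∈ F
  ff_notMem : ff ctx ∉ F
  or_mem : ∀ p, p ∈ F ∨ bneg p ∈ F

/-- Existence of a model that avoids a proper ideal of predicates. -/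
theorem exists_model {C : Ob} (I : Set (Mor E C Ob.nat)) (ff_mem : ff C ∈ I)
    (mono : ∀ p q, Entails p q → q ∈ I → p ∈ I)
    (cases : ∀ q p, band q p ∈ I → band q (bneg p) ∈ I → q ∈ I) (tt_notMem : tt C ∉ I) :
    ∃ M : Model E, ∃ h : M.ctx = C, ∀ p ∈ M.F, h ▸ p ∉ I := by
  -- Upward closure is not required: a maximal member decides every predicate anyway, and
  -- disjointness from `I` plays the role of properness.
  let Z : Set (Set (Mor E C Ob.nat)) :=
    {F | tt C ∈ F ∧ (∀ p ∈ F, ∀ q ∈ F, band p q ∈ F) ∧ ∀ p ∈ F, p ∉ I}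
  have h₀ : ({tt C} : Set (Mor E C Ob.nat)) ∈ Z := by
    refine ⟨rfl, ?_, ?_⟩
    · rintro p rfl q rfl
      simp
    · rintro p rfl
      exact tt_notMem
  obtain ⟨F, -, hF⟩ := zorn_subset_nonempty Z (by
    intro c hc hchain hne
    refine ⟨⋃₀ c, ⟨?_, ?_, ?_⟩, fun s hs => Set.subset_sUnion_of_mem hs⟩
    · obtain ⟨s, hs⟩ := hne
      exact ⟨s, hs, (hc hs).1⟩
    · rintro p ⟨s, hs, hp⟩ q ⟨t, ht, hq⟩
      rcases hchain.total hs ht with h | h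
      · exact ⟨t, ht, (hc ht).2.1 p (h hp) q hq⟩
      · exact ⟨s, hs, (hc hs).2.1 p hp q (h hq)⟩
    · rintro p ⟨s, hs, hp⟩
      exact (hc hs).2.2 p hp) _ h₀
  -- Otherwise the filter generated by `F` and `p` would still avoid `I`, against maximality.
  have key : ∀ p, p ∉ F → ∃ q ∈ F, band q p ∈ I := by
    intro p hp
    by_contra! hcon
    let F' : Set (Mor E C Ob.nat) := {r | ∃ q ∈ F, Entails (band q p) r}
    have hF' : F' ∈ Z := by
      refine ⟨⟨_, hF.prop.1, Entails.true _⟩, ?_, ?_⟩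
      · rintro r ⟨q, hq, hr⟩ r' ⟨q', hq', hr'⟩
        refine ⟨band q q', hF.prop.2.1 _ hq _ hq', Entails.and (Entails.trans ?_ hr)
          (Entails.trans ?_ hr')⟩
        · exact ((Entails.left _ _).trans (Entails.left _ _)).and (Entails.right _ _)
        · exact ((Entails.left _ _).trans (Entails.right _ _)).and (Entails.right _ _)
      · rintro r ⟨q, hq, hr⟩ hrI
        exact hcon q hq (mono _ _ hr hrI)
    have hsub : F ⊆ F' := fun q hq => ⟨q, hq, Entails.left _ _⟩
    exact hp (hF.le_of_ge hF' hsub ⟨_, hF.prop.1, Entails.right _ _⟩)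
  refine ⟨⟨C, F, hF.prop.1, hF.prop.2.1, fun h => hF.prop.2.2 _ h ff_mem, ?_⟩, rfl, hF.prop.2.2⟩
  intro p
  by_contra! hcon
  obtain ⟨q, hq, hqI⟩ := key p hcon.1
  obtain ⟨q', hq', hqI'⟩ := key _ hcon.2
  -- If neither `p` nor its negation is in `F`, then `band q q'` meets both of them in `I`; gluing
  -- puts this member of `F` itself into `I`.
  refine hF.prop.2.2 _ (hF.prop.2.1 _ hq _ hq') (cases _ p ?_ ?_)
  · exact mono _ _ (((Entails.left _ _).trans (Entails.left _ _)).and (Entails.right _ _)) hqI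
  · exact mono _ _ (((Entails.left _ _).trans (Entails.right _ _)).and (Entails.right _ _)) hqI'

namespace Model

/-- Equality on a set of the ultrafilter. -/
def setoid (M : Model E) (A : Ob) : Setoid (Mor E M.ctx A) where
  r f g := ∃ p ∈ M.F, CEq p f g
  iseqv := by
    refine ⟨fun f => ⟨_, M.tt_mem, CEq.refl _ f⟩, ?_, ?_⟩
    · rintro f g ⟨p, hp, h⟩
      exact ⟨p, hp, h.symm⟩
    · rintro f g k ⟨p, hp, h⟩ ⟨q, hq, h'⟩
      exact ⟨_, M.band_mem p hp q hq,
        (h.mono (Entails.left _ _)).trans (h'.mono (Entails.right _ _))⟩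

/-- The elements of the model of sort `A`. -/
def El (M : Model E) (A : Ob) : Type := Quotient (M.setoid A)

/-- The element given by a map on the context. -/
def el (M : Model E) {A : Ob} (f : Mor E M.ctx A) : M.El A := Quotient.mk (M.setoid A) f

variable {M : Model E}

theorem exists_el {A : Ob} (x : M.El A) : ∃ f, M.el f = x := Quotient.exists_rep x

theorem el_eq {A : Ob} {f g : Mor E M.ctx A} : M.el f = M.el g ↔ ∃ p ∈ M.F, CEq p f g :=
  Quotient.eq (r := M.setoid A)

/-- The action of a map on elements. -/
def ev {A B : Ob} (f : Mor E A B) : M.El A → M.El B :=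
  Quotient.map (sa := M.setoid A) (sb := M.setoid B) (fun x => f ⊚ x)
    (by rintro x y ⟨p, hp, h⟩; exact ⟨p, hp, h.comp f⟩)

/-- Pairs of elements. -/
def pr {A B : Ob} : M.El A → M.El B → M.El (Ob.prod A B) :=
  Quotient.map₂ (sa := M.setoid A) (sb := M.setoid B) (sc := M.setoid (Ob.prod A B)) Mor.pair
    (by
      rintro x y ⟨p, hp, h⟩ x' y' ⟨q, hq, h'⟩
      exact ⟨_, M.band_mem p hp q hq,
        (h.mono (Entails.left _ _)).pair (h'.mono (Entails.right _ _))⟩)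

instance : Zero (M.El Ob.nat) := ⟨M.el (ff _)⟩

theorem ev_el {A B : Ob} (f : Mor E A B) (x : Mor E M.ctx A) : ev f (M.el x) = M.el (f ⊚ x) := rfl

theorem pr_el {A B : Ob} (x : Mor E M.ctx A) (y : Mor E M.ctx B) :
    pr (M.el x) (M.el y) = M.el (pair x y) := rfl

theorem zero_def : (0 : M.El Ob.nat) = M.el (ff _) := rfl

@[simp] theorem ev_comp {A B C : Ob} (g : Mor E B C) (f : Mor E A B) (x : M.El A) :
    ev (g ⊚ f) x = ev g (ev f x) := by
  obtain ⟨x, rfl⟩ := exists_el x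
  simp [ev_el]

@[simp] theorem ev_id {A : Ob} (x : M.El A) : ev (Mor.id A) x = x := by
  obtain ⟨x, rfl⟩ := exists_el x
  simp [ev_el]

@[simp] theorem ev_pair {A B C : Ob} (f : Mor E C A) (g : Mor E C B) (x : M.El C) :
    ev (pair f g) x = pr (ev f x) (ev g x) := by
  obtain ⟨x, rfl⟩ := exists_el x
  simp [ev_el, pr_el]

@[simp] theorem ev_fst_pr {A B : Ob} (x : M.El A) (y : M.El B) : ev fst (pr x y) = x := by
  obtain ⟨x, rfl⟩ := exists_el x
  obtain ⟨y, rfl⟩ := exists_el y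
  simp [ev_el, pr_el]

@[simp] theorem ev_snd_pr {A B : Ob} (x : M.El A) (y : M.El B) : ev snd (pr x y) = y := by
  obtain ⟨x, rfl⟩ := exists_el x
  obtain ⟨y, rfl⟩ := exists_el y
  simp [ev_el, pr_el]

@[simp] theorem pr_eta {A B : Ob} (z : M.El (Ob.prod A B)) : pr (ev fst z) (ev snd z) = z := by
  obtain ⟨z, rfl⟩ := exists_el z
  simp [ev_el, pr_el, pair_eta]

theorem exists_pr {A B : Ob} (z : M.El (Ob.prod A B)) : ∃ x y, z = pr x y :=
  ⟨_, _, (pr_eta z).symm⟩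

@[simp] theorem pr_inj {A B : Ob} {x x' : M.El A} {y y' : M.El B} :
    pr x y = pr x' y' ↔ x = x' ∧ y = y' := by
  constructor
  · intro h
    exact ⟨by simpa using congrArg (ev fst) h, by simpa using congrArg (ev snd) h⟩
  · rintro ⟨rfl, rfl⟩
    rfl

theorem eq_of_one (x y : M.El Ob.one) : x = y := by
  obtain ⟨x, rfl⟩ := exists_el x
  obtain ⟨y, rfl⟩ := exists_el y
  rw [bang_uniq x y]

@[simp] theorem ev_zero (x : M.El Ob.one) : ev zero x = 0 := by
  obtain ⟨x, rfl⟩ := exists_el x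
  simp [ev_el, zero_eq_ff, zero_def]

@[simp] theorem ev_ff {A : Ob} (x : M.El A) : ev (ff A) x = 0 := by simp [ff]

@[simp] theorem ev_tt {A : Ob} (x : M.El A) : ev (tt A) x = ev succ 0 := by simp [tt]

@[simp] theorem ev_pre_succ (x : M.El Ob.nat) : ev pre (ev succ x) = x := by
  obtain ⟨x, rfl⟩ := exists_el x
  simp [ev_el]

@[simp] theorem ev_succ_inj {x y : M.El Ob.nat} : ev succ x = ev succ y ↔ x = y :=
  ⟨fun h => by simpa using congrArg (ev pre) h, fun h => h ▸ rfl⟩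

-- A condition under which a successor equals zero must itself be false, as applying `sign` to both
-- sides shows; but falsity is not in the ultrafilter.
@[simp] theorem succ_ne_zero (x : M.El Ob.nat) : ev succ x ≠ 0 := by
  obtain ⟨x, rfl⟩ := exists_el x
  rw [zero_def, ev_el, Ne, el_eq]
  rintro ⟨p, hp, h⟩
  have h₁ : CEq p (tt _) (ff _) := by simpa using h.comp sign
  have h₂ : sign ⊚ p = ff _ := by
    have : Mor.ite p (tt _) (ff _) = sign ⊚ p := by
      have := cases_elt' (E := E) (Mor.ite (Mor.id _) (tt _) (ff _)) sign (by simp [ite_comp])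
        (by simp [ite_comp, sign_succ']
            simpa using ite_succ (Mor.id Ob.nat) (tt _) (ff _)) p
      simpa [ite_comp] using this
    rw [← this]; exact h₁
  have h₃ := M.band_mem p hp p hp
  rw [band_self, h₂] at h₃
  exact M.ff_notMem h₃

/-- The ultrafilter decides `x`, read as a predicate: where `x` holds it is the successor of its
predecessor, and where its negation holds it is zero. -/
theorem zero_or_succ (x : M.El Ob.nat) : x = 0 ∨ ∃ y, x = ev succ y := by
  obtain ⟨x, rfl⟩ := exists_el x
  rcases M.or_mem x with h | h
  · right
    refine ⟨M.el (pre ⊚ x), ?_⟩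
    rw [ev_el, el_eq]
    refine ⟨x, h, ?_⟩
    have := cases_elt' (E := E) (Mor.ite (Mor.id _) (Mor.id _) (succ ⊚ pre)) (succ ⊚ pre)
      (by simp [ite_comp]) (by
        have h' := pre_succ (E := E) (Mor.id Ob.nat)
        simp only [comp_id] at h'
        simp [ite_comp, h']) x
    simpa [ite_comp, CEq] using this
  · left
    rw [zero_def, el_eq]
    refine ⟨_, h, ?_⟩
    have := cases_elt' (E := E) (Mor.ite neg (Mor.id _) (ff _)) (ff _)
      (by simp [ite_comp]) (by simp [ite_comp, neg_succ']) x
    simpa [ite_comp, CEq, bneg] using this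

@[simp] theorem ev_iter_zero {A : Ob} (f : Mor E A A) (x : M.El A) :
    ev (iter f) (pr x 0) = x := by
  obtain ⟨x, rfl⟩ := exists_el x
  simp [ev_el, pr_el, zero_def, ff]

@[simp] theorem ev_iter_succ {A : Ob} (f : Mor E A A) (x : M.El A) (n : M.El Ob.nat) :
    ev (iter f) (pr x (ev succ n)) = ev f (ev (iter f) (pr x n)) := by
  obtain ⟨x, rfl⟩ := exists_el x
  obtain ⟨n, rfl⟩ := exists_el n
  simp [ev_el, pr_el]

@[simp] theorem ev_prr_zero {A B : Ob} (g : Mor E A B)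
    (h : Mor E (Ob.prod (Ob.prod A Ob.nat) B) B) (x : M.El A) :
    ev (prr g h) (pr x 0) = ev g x := by
  obtain ⟨x, rfl⟩ := exists_el x
  simp [ev_el, pr_el, zero_def, ff]

@[simp] theorem ev_prr_succ {A B : Ob} (g : Mor E A B)
    (h : Mor E (Ob.prod (Ob.prod A Ob.nat) B) B) (x : M.El A) (n : M.El Ob.nat) :
    ev (prr g h) (pr x (ev succ n)) = ev h (pr (pr x n) (ev (prr g h) (pr x n))) := by
  obtain ⟨x, rfl⟩ := exists_el x
  obtain ⟨n, rfl⟩ := exists_el n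
  simp [ev_el, pr_el]

end Model

open Model

/-- Completeness for equations. -/
theorem eq_of_ev {A B : Ob} {f g : Mor E A B} (h : ∀ (M : Model E) (x : M.El A), ev f x = ev g x) :
    f = g := by
  by_contra hfg
  -- The ideal of conditions under which `f` and `g` agree is proper precisely because `f ≠ g`.
  obtain ⟨M, rfl, hM⟩ := exists_model {p | CEq p f g} (ite_ff _ _)
    (fun p q hpq hq => CEq.mono hpq hq) (fun q p h h' => CEq.cases h h')
    (fun h' => hfg ((ite_tt f g).symm.trans h'))
  -- Equality at the generic element, the class of the identity, gives a condition in the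
  -- ultrafilter under which `f` and `g` agree.
  have := h M (M.el (Mor.id _))
  rw [ev_el, ev_el, comp_id, comp_id, el_eq] at this
  obtain ⟨p, hp, h'⟩ := this
  exact hM p hp h'

/-! ## Arithmetic and logic in models -/

namespace Model

variable {M : Model E}

/-- Truth of a number. -/
def T (n : M.El Ob.nat) : Prop := n ≠ 0

@[simp] theorem T_zero : ¬ T (0 : M.El Ob.nat) := fun h => h rfl

@[simp] theorem T_succ (n : M.El Ob.nat) : T (ev succ n) := succ_ne_zero n

theorem not_T {n : M.El Ob.nat} : ¬ T n ↔ n = 0 := not_not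

@[simp] theorem T_sign (n : M.El Ob.nat) : T (ev sign n) ↔ T n := by
  rcases zero_or_succ n with rfl | ⟨n, rfl⟩ <;> simp [sign]

@[simp] theorem T_neg (n : M.El Ob.nat) : T (ev neg n) ↔ ¬ T n := by
  rcases zero_or_succ n with rfl | ⟨n, rfl⟩ <;> simp [neg]

/-- Makes the conjunction a function of two values, so that `T_band` can be settled by cases on each
of them. -/
theorem ev_band_eq {A : Ob} (p q : Mor E A Ob.nat) (x : M.El A) :
    ev (band p q) x = ev (band fst snd) (pr (ev p x) (ev q x)) := by
  simp [band]

@[simp] theorem T_band {A : Ob} (p q : Mor E A Ob.nat) (x : M.El A) :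
    T (ev (band p q) x) ↔ T (ev p x) ∧ T (ev q x) := by
  rw [ev_band_eq]
  generalize ev p x = m
  generalize ev q x = n
  have h₁ : ev (band fst snd) (pr m 0) = 0 := by
    have := congrArg (fun k => ev k m) (band_zero_right (E := E) (Mor.id _))
    simpa [band] using this
  have h₂ : ev (band fst snd) (pr 0 n) = 0 := by
    have := congrArg (fun k => ev k n) (band_zero_left (E := E) (Mor.id _))
    simpa [band] using this
  rcases zero_or_succ m with rfl | ⟨m, rfl⟩
  · simp [h₂]
  rcases zero_or_succ n with rfl | ⟨n, rfl⟩
  · simp [h₁]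
  have := congrArg (fun k => ev k (pr m n)) (band_succ_succ (E := E) fst snd)
  have h₃ : ev (band fst snd) (pr (ev succ m) (ev succ n)) = ev succ 0 := by
    simpa [band] using this
  simp [h₃]

@[simp] theorem T_bneg {A : Ob} (p : Mor E A Ob.nat) (x : M.El A) :
    T (ev (bneg p) x) ↔ ¬ T (ev p x) := by simp [bneg]

@[simp] theorem T_bimp {A : Ob} (p q : Mor E A Ob.nat) (x : M.El A) :
    T (ev (bimp p q) x) ↔ (T (ev p x) → T (ev q x)) := by
  simp [bimp]

theorem eq_one_of_T {A : Ob} {p : Mor E A Ob.nat} (hp : sign ⊚ p = p) {x : M.El A}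
    (h : T (ev p x)) : ev p x = ev succ 0 := by
  rw [← hp] at h ⊢
  rw [ev_comp] at h ⊢
  rw [T_sign] at h
  rcases zero_or_succ (ev p x) with h' | ⟨n, h'⟩
  · exact absurd h' h
  · simp [h', sign]

theorem ev_ite_of {A B : Ob} {c : Mor E A Ob.nat} (f g : Mor E A B) {x : M.El A}
    (h : T (ev c x)) : ev (Mor.ite c f g) x = ev f x := by
  rcases zero_or_succ (ev c x) with h' | ⟨n, h'⟩
  · exact absurd h' h
  · simp [Mor.ite, h']

theorem ev_ite_not {A B : Ob} {c : Mor E A Ob.nat} (f g : Mor E A B) {x : M.El A}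
    (h : ¬ T (ev c x)) : ev (Mor.ite c f g) x = ev g x := by
  simp [Mor.ite, not_T.1 h]

end Model

/-- Soundness and completeness for implications of predicates. -/
theorem entails_iff_ev {A : Ob} {p q : Mor E A Ob.nat} :
    Entails p q ↔ ∀ (M : Model E) (x : M.El A), T (ev p x) → T (ev q x) := by
  constructor
  · intro h M x
    rw [← T_bimp, show bimp p q = tt A from h]
    simp
  · intro h
    apply eq_of_ev
    intro M x
    rw [ev_tt]
    refine eq_one_of_T ?_ ((T_bimp _ _ _).2 (h M x))
    simp [bimp, bneg, sign_neg]

/-- Induction on a predicate. -/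
theorem induction {A : Ob} (p : Mor E (Ob.prod A Ob.nat) Ob.nat)
    (zero : ∀ (M : Model E) (x : M.El A), T (ev p (pr x 0)))
    (succ : ∀ (M : Model E) (x : M.El A) (n : M.El Ob.nat), T (ev p (pr x n)) →
      T (ev p (pr x (ev Mor.succ n))))
    {M : Model E} (x : M.El A) (n : M.El Ob.nat) : T (ev p (pr x n)) := by
  -- The induction step says that `p` is an invariant of `(x, n) ↦ (x, s n)`, hence of its iterated.
  have h : Entails p (p ⊚ pair fst (Mor.succ ⊚ snd)) := by
    rw [entails_iff_ev]
    intro M z hz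
    obtain ⟨x, n, rfl⟩ := exists_pr z
    simpa using succ M x n hz
  have h₁ := entails_iff_ev.1 h.iter M (pr (pr x 0) n) (by simpa using zero M x)
  -- Counting `n` steps up from `(x, 0)` leads to `(x, n)`, which carries the invariant to an
  -- arbitrary pair.
  have h₂ : iter (pair fst (Mor.succ ⊚ snd)) ⊚ pair (pair fst (ff _)) snd =
      Mor.id (E := E) (Ob.prod A Ob.nat) := by
    apply freyd_ext (pair fst (Mor.succ ⊚ snd)) <;> simp [ff]
  have h₃ := congrArg (fun k => ev k (pr x n)) h₂
  simp only [ev_comp, ev_pair, ev_fst_pr, ev_snd_pr, ev_ff, ev_id] at h₃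
  rwa [ev_comp, h₃] at h₁

/-- Uniqueness of maps defined by primitive recursion. -/
theorem prr_uniq {A B : Ob} (g : Mor E (Ob.prod (Ob.prod A Ob.nat) B) B)
    {f f' : Mor E (Ob.prod A Ob.nat) B}
    (zero : ∀ (M : Model E) (x : M.El A), ev f (pr x 0) = ev f' (pr x 0))
    (succ : ∀ (M : Model E) (x : M.El A) (n : M.El Ob.nat),
      ev f (pr x (ev Mor.succ n)) = ev g (pr (pr x n) (ev f (pr x n))))
    (succ' : ∀ (M : Model E) (x : M.El A) (n : M.El Ob.nat),
      ev f' (pr x (ev Mor.succ n)) = ev g (pr (pr x n) (ev f' (pr x n))))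
    {M : Model E} (x : M.El A) (n : M.El Ob.nat) : ev f (pr x n) = ev f' (pr x n) := by
  -- Carrying the argument along turns the recursion into a plain iteration, to which Freyd's
  -- uniqueness applies.
  have key : pair (Mor.id _) f = pair (Mor.id _) f' := by
    apply freyd_ext (pair (pair (fst ⊚ fst) (Mor.succ ⊚ snd ⊚ fst)) g)
    all_goals
      apply eq_of_ev
      intro M z
    · simp
      simpa using zero M z
    · obtain ⟨x, n, rfl⟩ := exists_pr z
      simp [succ]
    · obtain ⟨x, n, rfl⟩ := exists_pr z
      simp [succ']
  simpa using congrArg (fun k => ev (snd ⊚ k) (pr x n)) key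

namespace Model

variable {M : Model E}

/-! ### Subtraction and equality -/

@[simp] theorem ev_pre_zero : ev pre (0 : M.El Ob.nat) = 0 := by simp [pre]

@[simp] theorem sub_zero (x : M.El Ob.nat) : ev sub (pr x 0) = x := by simp [sub]

theorem sub_succ (x y : M.El Ob.nat) : ev sub (pr x (ev succ y)) = ev pre (ev sub (pr x y)) := by
  simp [sub]

@[simp] theorem succ_sub_succ (x y : M.El Ob.nat) :
    ev sub (pr (ev succ x) (ev succ y)) = ev sub (pr x y) := by
  have := prr_uniq (E := E) (A := Ob.nat) (pre ⊚ snd)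
    (f := sub ⊚ pair (succ ⊚ fst) (succ ⊚ snd)) (f' := sub)
    (by intros; simp [sub_succ]) (by intros; simp [sub_succ]) (by intros; simp [sub_succ]) x y
  simpa using this

@[simp] theorem sub_self (y : M.El Ob.nat) : ev sub (pr y y) = 0 := by
  have := prr_uniq (E := E) (A := Ob.nat) snd
    (f := sub ⊚ pair snd snd) (f' := ff _)
    (by intros; simp) (by intros; simp) (by intros; simp) y y
  simpa using this

/-- Uniqueness for the recursion along both arguments. -/
theorem diag_uniq {f f' : Mor E (Ob.prod Ob.nat Ob.nat) Ob.nat}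
    (h₀ : ∀ (M : Model E) (y : M.El Ob.nat), ev f (pr 0 y) = y ∧ ev f' (pr 0 y) = y)
    (h₁ : ∀ (M : Model E) (x : M.El Ob.nat), ev f (pr x 0) = 0 ∧ ev f' (pr x 0) = 0)
    (h₂ : ∀ (M : Model E) (x y : M.El Ob.nat),
      ev f (pr (ev succ x) (ev succ y)) = ev succ (ev f (pr x y)) ∧
      ev f' (pr (ev succ x) (ev succ y)) = ev succ (ev f' (pr x y)))
    (x y : M.El Ob.nat) : ev f (pr x y) = ev f' (pr x y) := by
  -- With `c = x ∸ n`, the point `(u, v) = (x ∸ c, y ∸ c)` runs along the diagonal from `(0, y ∸ x)`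
  -- at `n = 0` to `(x, y)` at `n = x`. The map `g` tests the coordinates of the next point, via
  -- `σ`, to see whether a boundary equation or the successor equation applies.
  let c : Mor E (Ob.prod (Ob.prod Ob.nat Ob.nat) Ob.nat) Ob.nat := sub ⊚ pair (fst ⊚ fst) snd
  let u : Mor E (Ob.prod (Ob.prod Ob.nat Ob.nat) Ob.nat) Ob.nat := sub ⊚ pair (fst ⊚ fst) c
  let v : Mor E (Ob.prod (Ob.prod Ob.nat Ob.nat) Ob.nat) Ob.nat := sub ⊚ pair (snd ⊚ fst) c
  let σ : Mor E (Ob.prod (Ob.prod Ob.nat Ob.nat) Ob.nat) _ := pair fst (succ ⊚ snd)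
  let g := Mor.ite (c ⊚ fst) (Mor.ite (u ⊚ σ ⊚ fst) (Mor.ite (v ⊚ σ ⊚ fst) (succ ⊚ snd) (ff _))
    (v ⊚ σ ⊚ fst)) snd
  have key : ∀ (k : Mor E (Ob.prod Ob.nat Ob.nat) Ob.nat)
    (_ : ∀ (M : Model E) (y : M.El Ob.nat), ev k (pr 0 y) = y)
    (_ : ∀ (M : Model E) (x : M.El Ob.nat), ev k (pr x 0) = 0)
    (_ : ∀ (M : Model E) (x y : M.El Ob.nat),
      ev k (pr (ev succ x) (ev succ y)) = ev succ (ev k (pr x y))) (M : Model E)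
      (z : M.El (Ob.prod Ob.nat Ob.nat)) (n : M.El Ob.nat),
      ev (k ⊚ pair u v) (pr z (ev succ n)) = ev g (pr (pr z n) (ev (k ⊚ pair u v) (pr z n))) := by
    intro k k₀ k₁ k₂ M z n
    obtain ⟨x, y, rfl⟩ := exists_pr z
    by_cases hc : T (ev c (pr (pr x y) n))
    · rw [ev_ite_of _ _ (by simpa using hc)]
      have hc' : ∃ m, ev sub (pr x n) = ev succ m := by
        rcases zero_or_succ (ev sub (pr x n)) with h | h
        · simp [c, h] at hc
        · exact h
      obtain ⟨m, hm⟩ := hc'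
      by_cases hu : T (ev u (pr (pr x y) (ev succ n)))
      · rw [ev_ite_of _ _ (by simpa [σ] using hu)]
        by_cases hv : T (ev v (pr (pr x y) (ev succ n)))
        · rw [ev_ite_of _ _ (by simpa [σ] using hv)]
          simp only [u, v, c, ev_comp, ev_pair, ev_fst_pr, ev_snd_pr, sub_succ, hm,
            ev_pre_succ] at hu hv ⊢
          rcases zero_or_succ (ev sub (pr x m)) with h | ⟨i, hi⟩
          · exact absurd h hu
          rcases zero_or_succ (ev sub (pr y m)) with h | ⟨j, hj⟩
          · exact absurd h hv
          rw [hi, hj, k₂, ev_pre_succ, ev_pre_succ]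
        · rw [ev_ite_not _ _ (by simpa [σ] using hv)]
          simp only [ev_comp, ev_pair, not_T.1 hv, k₁, ev_ff]
      · rw [ev_ite_not _ _ (by simpa [σ] using hu)]
        simp only [ev_comp, ev_pair, not_T.1 hu, k₀, σ, ev_fst_pr, ev_snd_pr]
    · rw [ev_ite_not _ _ (by simpa using hc)]
      have hc' := not_T.1 hc
      simp only [c, ev_comp, ev_pair, ev_fst_pr, ev_snd_pr] at hc'
      simp [u, v, c, hc', sub_succ]
  have := prr_uniq (E := E) g (f := f ⊚ pair u v) (f' := f' ⊚ pair u v)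
    (by
      intro M z
      obtain ⟨x, y, rfl⟩ := exists_pr z
      simp [u, v, c, h₀])
    (key f (fun M y => (h₀ M y).1) (fun M y => (h₁ M y).1) (fun M x y => (h₂ M x y).1))
    (key f' (fun M y => (h₀ M y).2) (fun M y => (h₁ M y).2) (fun M x y => (h₂ M x y).2))
    (pr x y) x
  simpa [u, v, c] using this

/-- The map that returns `x` where both differences vanish and `y` elsewhere obeys the same diagonal
recursion as the second projection, so it always returns `y`. -/
theorem eq_of_sub_eq_zero {x y : M.El Ob.nat} (h : ev sub (pr x y) = 0)
    (h' : ev sub (pr y x) = 0) : x = y := by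
  let c : Mor E (Ob.prod Ob.nat Ob.nat) Ob.nat := band (ble fst snd) (ble snd fst)
  have hc : ∀ {M : Model E} (x y : M.El Ob.nat), T (ev c (pr x y)) ↔
      ev sub (pr x y) = 0 ∧ ev sub (pr y x) = 0 := by
    intro M x y
    simp [c, ble, not_T]
  have := diag_uniq (E := E) (f := Mor.ite c fst snd) (f' := snd) (M := M) ?_ ?_ ?_ x y
  · rw [ev_ite_of _ _ ((hc _ _).2 ⟨h, h'⟩)] at this
    simpa using this
  · intro M y
    refine ⟨?_, by simp⟩
    by_cases hy : T (ev c (pr 0 y))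
    · rw [ev_ite_of _ _ hy]
      simpa using ((hc _ _).1 hy).2.symm
    · rw [ev_ite_not _ _ hy]
      simp
  · intro M y
    refine ⟨?_, by simp⟩
    by_cases hy : T (ev c (pr y 0))
    · rw [ev_ite_of _ _ hy]
      simpa using ((hc _ _).1 hy).1
    · rw [ev_ite_not _ _ hy]
      simp
  · intro M x y
    refine ⟨?_, by simp⟩
    have hs : T (ev c (pr (ev succ x) (ev succ y))) ↔ T (ev c (pr x y)) := by
      rw [hc, hc, succ_sub_succ, succ_sub_succ]
    by_cases hy : T (ev c (pr x y))
    · rw [ev_ite_of _ _ (hs.2 hy), ev_ite_of _ _ hy]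
      simp
    · rw [ev_ite_not _ _ (fun h => hy (hs.1 h)), ev_ite_not _ _ hy]
      simp

/-- Predicative equality is equality of values. -/
@[simp] theorem T_beq {A B : Ob} (f g : Mor E A B) (x : M.El A) :
    T (ev (beq f g) x) ↔ ev f x = ev g x := by
  induction B with
  | one => simp [beq, eq_of_one (ev f x) (ev g x)]
  | nat =>
    rw [beq, T_band]
    simp only [ble, ev_comp, T_neg, not_T, ev_pair]
    exact ⟨fun h => eq_of_sub_eq_zero h.1 h.2, fun h => by simp [h]⟩
  | prod B C hB hC =>
    rw [beq, T_band, hB, hC]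
    simp only [ev_comp]
    rw [← pr_inj, pr_eta, pr_eta]

/-! ### Addition -/

@[simp] theorem add_zero (x : M.El Ob.nat) : ev add (pr x 0) = x := by simp [add]

@[simp] theorem add_succ (x y : M.El Ob.nat) :
    ev add (pr x (ev succ y)) = ev succ (ev add (pr x y)) := by simp [add]

@[simp] theorem zero_add (x : M.El Ob.nat) : ev add (pr 0 x) = x := by
  have := induction (E := E) (A := Ob.nat) (beq (add ⊚ pair (ff _) snd) snd)
    (by simp) (by simp) x x
  simpa using this

@[simp] theorem succ_add (x y : M.El Ob.nat) :
    ev add (pr (ev succ x) y) = ev succ (ev add (pr x y)) := by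
  have := induction (E := E) (A := Ob.nat) (beq (add ⊚ pair (succ ⊚ fst) snd) (succ ⊚ add))
    (by simp) (by simp) x y
  simpa using this

theorem add_comm (x y : M.El Ob.nat) : ev add (pr x y) = ev add (pr y x) := by
  have := induction (E := E) (A := Ob.nat) (beq add (add ⊚ pair snd fst))
    (by simp) (by simp) x y
  simpa using this

@[simp] theorem add_sub_cancel (x y : M.El Ob.nat) : ev sub (pr (ev add (pr y x)) x) = y := by
  have := induction (E := E) (A := Ob.nat) (beq (sub ⊚ pair add snd) fst)
    (by simp) (by simp) y x
  simpa using this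

/-- The existential is traded for a predicate with the explicit candidates `y ∸ x` and `x ∸ y`,
since induction needs a map. -/
theorem exists_add (x y : M.El Ob.nat) :
    ∃ c, y = ev add (pr x c) ∨ x = ev add (pr y c) := by
  let p : Mor E (Ob.prod Ob.nat Ob.nat) Ob.nat :=
    bimp (bneg (beq snd (add ⊚ pair fst (sub ⊚ pair snd fst))))
      (beq fst (add ⊚ pair snd (sub ⊚ pair fst snd)))
  have hp : ∀ {M : Model E} (x y : M.El Ob.nat), T (ev p (pr x y)) ↔
      ∃ c, y = ev add (pr x c) ∨ x = ev add (pr y c) := by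
    intro M x y
    simp only [p, T_bimp, T_bneg, T_beq, ev_comp, ev_pair, ev_fst_pr, ev_snd_pr]
    constructor
    · intro h
      by_cases h' : y = ev add (pr x (ev sub (pr y x)))
      · exact ⟨_, Or.inl h'⟩
      · exact ⟨_, Or.inr (h h')⟩
    · rintro ⟨c, h | h⟩ h'
      · rw [h, add_comm, add_sub_cancel] at h'
        exact absurd (add_comm _ _) h'
      · rw [h, add_comm, add_sub_cancel, add_comm]
  rw [← hp]
  refine induction p ?_ ?_ x y
  · intro M x
    exact (hp _ _).2 ⟨x, Or.inr (by simp)⟩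
  · intro M x n h
    rw [hp] at h ⊢
    obtain ⟨c, rfl | rfl⟩ := h
    · exact ⟨ev succ c, Or.inl (by simp)⟩
    · rcases zero_or_succ c with rfl | ⟨c, rfl⟩
      · exact ⟨ev succ 0, Or.inl (by simp)⟩
      · exact ⟨c, Or.inr (by simp)⟩

/-! ### The count is surjective -/

theorem iter_add {A : Ob} (f : Mor E A A) (x : M.El A) (m n : M.El Ob.nat) :
    ev (iter f) (pr x (ev add (pr m n))) = ev (iter f) (pr (ev (iter f) (pr x m)) n) := by
  have := induction (E := E) (beq (iter f ⊚ pair (fst ⊚ fst) (add ⊚ pair (snd ⊚ fst) snd))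
    (iter f ⊚ pair (iter f ⊚ fst) snd)) (by
      intro M z
      obtain ⟨x, m, rfl⟩ := exists_pr z
      simp) (by
      intro M z n
      obtain ⟨x, m, rfl⟩ := exists_pr z
      simp +contextual) (pr x m) n
  simpa using this

/-- The step of the Cantor enumeration. -/
def cantorStep : Mor E (Ob.prod Ob.nat Ob.nat) (Ob.prod Ob.nat Ob.nat) :=
  Mor.ite snd (pair (succ ⊚ fst) (pre ⊚ snd)) (pair (ff _) (succ ⊚ fst))

theorem cantor_eq (n : M.El Ob.nat) :
    ev cantor n = ev (iter cantorStep) (pr (pr 0 0) n) := by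
  simp [cantor, cantorStep]

@[simp] theorem cantorStep_succ (x y : M.El Ob.nat) :
    ev cantorStep (pr x (ev succ y)) = pr (ev succ x) y := by
  rw [cantorStep, ev_ite_of _ _ (by simp)]
  simp

@[simp] theorem cantorStep_zero (x : M.El Ob.nat) :
    ev cantorStep (pr x 0) = pr 0 (ev succ x) := by
  rw [cantorStep, ev_ite_not _ _ (by simp)]
  simp

/-- Before the diagonal ends, each step moves one unit from the second coordinate to the first. The
guard is needed because a truncated difference of zero does not tell the end of the diagonal from
points beyond it. -/
theorem iter_cantorStep_aux (n k : M.El Ob.nat) (h : ev sub (pr n k) ≠ 0) :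
    ev (iter cantorStep) (pr (pr 0 n) k) = pr k (ev sub (pr n k)) := by
  have := induction (E := E) (A := Ob.nat) (bimp sub
    (beq (iter cantorStep ⊚ pair (pair (ff _) fst) snd) (pair snd sub))) (by simp) (by
      intro M n k
      simp only [T_bimp, T_beq, ev_comp, ev_pair, ev_fst_pr, ev_snd_pr, ev_ff, ev_iter_succ,
        sub_succ]
      intro h h'
      rcases zero_or_succ (ev sub (pr n k)) with h₀ | ⟨m, h₀⟩
      · simp [h₀] at h'
      · rw [h (by simp [h₀]), h₀]
        simp) n k
  simp only [T_bimp, T_beq, ev_comp, ev_pair, ev_fst_pr, ev_snd_pr, ev_ff] at this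
  exact this h

/-- The end point of a diagonal, `y = 0`, is outside the guard of `iter_cantorStep_aux`; it is
reached by one more step from `(x - 1, 1)`. -/
theorem iter_cantorStep (x y : M.El Ob.nat) :
    ev (iter cantorStep) (pr (pr 0 (ev add (pr y x))) x) = pr x y := by
  rcases zero_or_succ y with rfl | ⟨y, rfl⟩
  · rcases zero_or_succ x with rfl | ⟨x, rfl⟩
    · simp
    · have h : ev sub (pr (ev succ x) x) = ev succ 0 := by
        simpa using add_sub_cancel x (ev succ 0)
      rw [zero_add, ev_iter_succ, iter_cantorStep_aux _ _ (by simp [h]), h]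
      simp
  · rw [iter_cantorStep_aux] <;> rw [add_sub_cancel]
    simp

/-- Triangular numbers. -/
def tri : Mor E (Ob.prod Ob.one Ob.nat) Ob.nat :=
  prr (ff _) (succ ⊚ add ⊚ pair snd (snd ⊚ fst))

/-- The triangular number is the position at which a diagonal starts: from `(0, n)`, `n` steps lead
to `(n, 0)` and one more wraps around to `(0, n + 1)`. -/
theorem cantor_tri (o : M.El Ob.one) (n : M.El Ob.nat) :
    ev cantor (ev tri (pr o n)) = pr 0 n := by
  have := induction (E := E) (A := Ob.one) (beq (cantor ⊚ tri) (pair (ff _) snd))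
    (by simp [tri, cantor_eq]) (by
      intro M o n
      simp only [T_beq, ev_comp, ev_pair, ev_ff, ev_snd_pr]
      intro h
      have h' : ev tri (pr o (ev succ n)) = ev succ (ev add (pr (ev tri (pr o n)) n)) := by
        simp [tri]
      have h₂ := iter_cantorStep n (0 : M.El Ob.nat)
      rw [zero_add] at h₂
      rw [h', cantor_eq, ev_iter_succ, iter_add, ← cantor_eq, h, h₂, cantorStep_zero]) o n
  simpa using this

theorem cantor_surjective : Function.Surjective (ev cantor : M.El Ob.nat → _) := by
  intro z
  obtain ⟨x, y, rfl⟩ := exists_pr z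
  -- The start of the diagonal through `(x, y)`, followed by `x` steps along it.
  refine ⟨ev add (pr (ev tri (pr (ev (bang _) x) (ev add (pr y x)))) x), ?_⟩
  rw [cantor_eq, iter_add, ← cantor_eq, cantor_tri, iter_cantorStep]

theorem cnt_surjective (D : Ob) : Function.Surjective (ev (cnt D) : M.El Ob.nat → _) := by
  induction D with
  | one => exact fun x => ⟨0, eq_of_one _ _⟩
  | nat => exact fun x => ⟨x, by simp [cnt]⟩
  | prod A B hA hB =>
    intro z
    obtain ⟨x, y, rfl⟩ := exists_pr z
    obtain ⟨m, rfl⟩ := hA x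
    obtain ⟨n, rfl⟩ := hB y
    obtain ⟨k, hk⟩ := cantor_surjective (pr m n)
    exact ⟨k, by simp [cnt, hk]⟩

end Model

/-- A total existence statement on models is witnessed by a map. -/
theorem exists_mor {A B : Ob} (p : Mor E A Ob.nat) (P : Mor E (Ob.prod A B) Ob.nat)
    (h : ∀ (M : Model E) (x : M.El A), T (ev p x) → ∃ y, T (ev P (pr x y))) :
    ∃ i : Mor E A B, ∀ (M : Model E) (x : M.El A), T (ev p x) → T (ev P (pr x (ev i x))) := by
  -- The conditions under which one map supplies all witnesses. Case distinction glues two such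
  -- maps, so this is an ideal, and the goal is that it contains truth.
  let I : Set (Mor E A Ob.nat) := {q | ∃ i : Mor E A B, ∀ (M : Model E) (x : M.El A),
    T (ev p x) → T (ev q x) → T (ev P (pr x (ev i x)))}
  by_cases htt : tt A ∈ I
  · obtain ⟨i, hi⟩ := htt
    exact ⟨i, fun M x hx => hi M x hx (by simp)⟩
  exfalso
  obtain ⟨M, rfl, hM⟩ := exists_model I ⟨cnt B ⊚ ff A, fun M x _ h => by simp at h⟩
    (by
      rintro q r hqr ⟨i, hi⟩
      exact ⟨i, fun M x hx hq => hi M x hx (entails_iff_ev.1 hqr M x hq)⟩)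
    (by
      rintro q r ⟨i, hi⟩ ⟨j, hj⟩
      refine ⟨Mor.ite r i j, fun M x hx hq => ?_⟩
      by_cases hr : T (ev r x)
      · rw [ev_ite_of _ _ hr]
        exact hi M x hx (by simp [hq, hr])
      · rw [ev_ite_not _ _ hr]
        exact hj M x hx (by simp [hq, hr])) htt
  -- A predicate true at the generic element is in the ultrafilter: otherwise its negation is, and
  -- under that condition the predicate vanishes.
  have hmem : ∀ q : Mor E M.ctx Ob.nat, T (ev q (M.el (Mor.id _))) → q ∈ M.F := by
    intro q hq
    refine (M.or_mem q).resolve_right fun hq' => hq ?_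
    rw [ev_el, comp_id, zero_def, el_eq]
    refine ⟨_, hq', ?_⟩
    apply eq_of_ev
    intro M x
    by_cases hx : T (ev q x)
    · rw [ev_ite_not _ _ (by simpa using hx)]
    · rw [ev_ite_of _ _ (by simpa using hx), not_T.1 hx, ev_ff]
  by_cases hp : T (ev p (M.el (Mor.id _)))
  · obtain ⟨y, hy⟩ := h M _ hp
    obtain ⟨i, rfl⟩ := exists_el y
    -- A witness for the generic element is the class of a map `i`. The condition that `i` is a
    -- correct witness lies both in the ultrafilter and in the ideal.
    refine hM (P ⊚ pair (Mor.id _) i) (hmem _ ?_) ⟨i, fun M x _ hx => by simpa using hx⟩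
    simpa [ev_el, pr_el] using hy
  · refine hM (bneg p) (hmem _ (by simpa using hp)) ⟨cnt B ⊚ ff _, fun M x hx hx' => ?_⟩
    simp [hx] at hx'

/-! ## Graphs of relations in models -/

theorem SMap.ev_ok {A B : Obj E} (f : SMap A B) {M : Model E} {x : M.El A.base}
    (h : T (ev A.pred x)) : T (ev B.pred (ev f.tm x)) := by
  simpa using entails_iff_ev.1 f.ok M x h

namespace Rel

/-- The graph of a relation on the elements of a model. -/
def Graph {A B : Obj E} (f : Rel A B) {M : Model E} (x : M.El A.base) (y : M.El B.base) : Prop :=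
  ∃ w, T (ev f.D.pred w) ∧ ev f.d.tm w = x ∧ ev f.rule.tm w = y

variable {M : Model E}

theorem Graph.dom {A B : Obj E} {f : Rel A B} {x : M.El A.base} {y : M.El B.base}
    (h : f.Graph x y) : T (ev A.pred x) := by
  obtain ⟨w, hw, rfl, -⟩ := h
  exact f.d.ev_ok hw

theorem Graph.cod {A B : Obj E} {f : Rel A B} {x : M.El A.base} {y : M.El B.base}
    (h : f.Graph x y) : T (ev B.pred y) := by
  obtain ⟨w, hw, -, rfl⟩ := h
  exact f.rule.ev_ok hw

/-- From graphs back to maps, `exists_mor` collects the witnesses found in the separate models into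
one comparison map. -/
theorem incl_iff {A B : Obj E} {f g : Rel A B} :
    f.Incl g ↔ ∀ (M : Model E) (x : M.El A.base) (y : M.El B.base), f.Graph x y → g.Graph x y := by
  constructor
  · rintro ⟨i, h, h'⟩ M x y ⟨w, hw, rfl, rfl⟩
    refine ⟨ev i.tm w, i.ev_ok hw, ?_, ?_⟩
    · simpa [SMap.comp] using entails_iff_ev.1 h M w hw
    · simpa [SMap.comp] using entails_iff_ev.1 h' M w hw
  · intro h
    obtain ⟨i, hi⟩ := exists_mor f.D.pred (band (g.D.pred ⊚ snd)
      (band (beq (g.d.tm ⊚ snd) (f.d.tm ⊚ fst)) (beq (g.rule.tm ⊚ snd) (f.rule.tm ⊚ fst))))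
      (by
        intro M w hw
        obtain ⟨v, hv, hv', hv''⟩ := h M _ _ ⟨w, hw, rfl, rfl⟩
        exact ⟨v, by simp [hv, hv', hv'']⟩)
    simp only [T_band, T_beq, ev_comp, ev_fst_pr, ev_snd_pr] at hi
    refine ⟨⟨i, entails_iff_ev.2 fun M w hw => by simpa using (hi M w hw).1⟩,
      entails_iff_ev.2 fun M w hw => ?_, entails_iff_ev.2 fun M w hw => ?_⟩
    · simpa [SMap.comp] using (hi M w hw).2.1
    · simpa [SMap.comp] using (hi M w hw).2.2

theorem pEq_iff {A B : Obj E} {f g : Rel A B} :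
    f.PEq g ↔ ∀ (M : Model E) (x : M.El A.base) (y : M.El B.base), f.Graph x y ↔ g.Graph x y := by
  simp only [PEq, incl_iff]
  exact ⟨fun h M x y => ⟨h.1 M x y, h.2 M x y⟩,
    fun h => ⟨fun M x y => (h M x y).1, fun M x y => (h M x y).2⟩⟩

theorem isPartial_iff {A B : Obj E} {f : Rel A B} :
    f.IsPartial ↔ ∀ (M : Model E) (x : M.El A.base) (y y' : M.El B.base),
      f.Graph x y → f.Graph x y' → y = y' := by
  rw [IsPartial, entails_iff_ev]
  constructor
  · rintro h M x y y' ⟨w, hw, rfl, rfl⟩ ⟨w', hw', hd, rfl⟩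
    have := h M (pr w w') (by simp [hw, hw'])
    simp only [T_bimp, T_beq, ev_comp, ev_fst_pr, ev_snd_pr] at this
    exact this hd.symm
  · intro h M z hz
    obtain ⟨w, w', rfl⟩ := exists_pr z
    simp only [T_band, ev_comp, ev_fst_pr, ev_snd_pr] at hz
    simp only [T_bimp, T_beq, ev_comp, ev_fst_pr, ev_snd_pr]
    intro hd
    exact h M _ _ _ ⟨w, hz.1, rfl, rfl⟩ ⟨w', hz.2, hd.symm, rfl⟩

theorem graph_emb {A B : Obj E} {f : SMap A B} {x : M.El A.base} {y : M.El B.base} :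
    (emb f).Graph x y ↔ T (ev A.pred x) ∧ ev f.tm x = y := by
  simp only [Graph, emb, SMap.id, ev_id]
  exact ⟨by rintro ⟨w, h, rfl, h'⟩; exact ⟨h, h'⟩, fun h => ⟨x, h.1, rfl, h.2⟩⟩

theorem graph_restr {A B : Obj E} {γ : SMap A Obj.two} {q : SMap (A.ext γ.tm) B}
    {x : M.El A.base} {y : M.El B.base} :
    (restr γ q).Graph x y ↔ T (ev A.pred x) ∧ T (ev γ.tm x) ∧ ev q.tm x = y := by
  simp only [Graph, restr, SMap.incl, ev_id, T_band]
  exact ⟨by rintro ⟨w, h, rfl, h'⟩; exact ⟨h.1, h.2, h'⟩, fun h => ⟨x, ⟨h.1, h.2.1⟩, rfl, h.2.2⟩⟩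

theorem graph_comp {A B C : Obj E} {g : Rel B C} {f : Rel A B}
    {x : M.El A.base} {z : M.El C.base} :
    (g.comp f).Graph x z ↔ ∃ y, f.Graph x y ∧ g.Graph y z := by
  simp only [Graph, comp, pb, pbl, pbr, SMap.comp, SMap.fst, SMap.snd, SMap.incl, T_band, T_beq,
    ev_comp, ev_id]
  constructor
  · rintro ⟨w, ⟨⟨h₁, h₂⟩, h₃⟩, h₄, h₅⟩
    exact ⟨_, ⟨_, h₁, h₄, rfl⟩, ⟨_, h₂, h₃.symm, h₅⟩⟩
  · rintro ⟨y, ⟨w, h₁, h₂, rfl⟩, ⟨w', h₃, h₄, h₅⟩⟩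
    exact ⟨pr w w', by simp [h₁, h₃, h₄], by simpa using h₂, by simpa using h₅⟩

theorem graph_prod {A B A' B' : Obj E} {f : Rel A B} {g : Rel A' B'}
    {x : M.El A.base} {x' : M.El A'.base} {y : M.El B.base} {y' : M.El B'.base} :
    (f.prod g).Graph (pr x x') (pr y y') ↔ f.Graph x y ∧ g.Graph x' y' := by
  simp only [Graph, prod, SMap.comp, SMap.pair, SMap.fst, SMap.snd, T_band,
    ev_comp, ev_pair, pr_inj]
  constructor
  · rintro ⟨w, ⟨h₁, h₂⟩, ⟨h₃, h₄⟩, h₅, h₆⟩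
    exact ⟨⟨_, h₁, h₃, h₅⟩, ⟨_, h₂, h₄, h₆⟩⟩
  · rintro ⟨⟨w, h₁, h₂, h₃⟩, ⟨w', h₄, h₅, h₆⟩⟩
    exact ⟨pr w w', by simp [h₁, h₄], by simp [h₂, h₅], by simp [h₃, h₆]⟩

theorem graph_mu {A : Obj E} {φ : SMap (A.prod Obj.nat) Obj.two}
    {x : M.El A.base} {y : M.El Ob.nat} :
    (mu φ).Graph x y ↔ T (ev A.pred x) ∧ ∃ n, T (ev φ.tm (pr x n)) ∧
      ev (bmin φ.tm) (pr x n) = y := by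
  simp only [Graph, mu, SMap.comp, SMap.fst, SMap.incl, SMap.ofNat, T_band, ev_comp, ev_id]
  constructor
  · rintro ⟨w, ⟨⟨h₁, -⟩, h₂⟩, rfl, h₃⟩
    exact ⟨h₁, ev snd w, by simpa using h₂, by simpa using h₃⟩
  · rintro ⟨h, n, h₁, h₂⟩
    exact ⟨pr x n, by simp [h, h₁], by simp, h₂⟩

/-! ### Partiality -/

theorem isPartial_emb {A B : Obj E} (f : SMap A B) : (emb f).IsPartial := by
  rw [isPartial_iff]
  intro M x y y' h h'
  rw [graph_emb] at h h'
  rw [← h.2, h'.2]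

theorem isPartial_restr {A B : Obj E} (γ : SMap A Obj.two) (q : SMap (A.ext γ.tm) B) :
    (restr γ q).IsPartial := by
  rw [isPartial_iff]
  intro M x y y' h h'
  rw [graph_restr] at h h'
  rw [← h.2.2, h'.2.2]

theorem IsPartial.comp {A B C : Obj E} {g : Rel B C} {f : Rel A B} (hg : g.IsPartial)
    (hf : f.IsPartial) : (g.comp f).IsPartial := by
  rw [isPartial_iff] at *
  intro M x y y' h h'
  rw [graph_comp] at h h'
  obtain ⟨z, h₁, h₂⟩ := h
  obtain ⟨z', h₁', h₂'⟩ := h'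
  obtain rfl := hf M _ _ _ h₁ h₁'
  exact hg M _ _ _ h₂ h₂'

theorem IsPartial.prod {A B A' B' : Obj E} {f : Rel A B} {g : Rel A' B'} (hf : f.IsPartial)
    (hg : g.IsPartial) : (f.prod g).IsPartial := by
  rw [isPartial_iff] at *
  intro M x y y' h h'
  obtain ⟨x, x', rfl⟩ := exists_pr x
  obtain ⟨y, z, rfl⟩ := exists_pr y
  obtain ⟨y', z', rfl⟩ := exists_pr y'
  rw [graph_prod] at h h'
  rw [hf M _ _ _ h.1 h'.1, hg M _ _ _ h.2 h'.2]

/-! ### The bounded minimum and single-valuedness of `μ` on predicates of `S` -/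

theorem bmin_zero {A : Ob} (φ : Mor E (Ob.prod A Ob.nat) Ob.nat) (x : M.El A) :
    ev (bmin φ) (pr x 0) = 0 := by simp [bmin]

theorem bmin_succ_of {A : Ob} {φ : Mor E (Ob.prod A Ob.nat) Ob.nat} {x : M.El A} {n : M.El Ob.nat}
    (h : T (ev φ (pr x (ev (bmin φ) (pr x n))))) :
    ev (bmin φ) (pr x (ev succ n)) = ev (bmin φ) (pr x n) := by
  rw [bmin, ev_prr_succ, ev_ite_of _ _ (by simpa [bmin] using h)]
  simp

theorem bmin_succ_not {A : Ob} {φ : Mor E (Ob.prod A Ob.nat) Ob.nat} {x : M.El A}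
    {n : M.El Ob.nat} (h : ¬ T (ev φ (pr x (ev (bmin φ) (pr x n))))) :
    ev (bmin φ) (pr x (ev succ n)) = ev succ n := by
  rw [bmin, ev_prr_succ, ev_ite_not _ _ (by simpa [bmin] using h)]
  simp

/-- No induction is needed: at a successor the bounded minimum either keeps a value that already
satisfies the predicate or takes the new bound, which does so by assumption. -/
theorem bmin_spec {A : Ob} {φ : Mor E (Ob.prod A Ob.nat) Ob.nat} {x : M.El A} {n : M.El Ob.nat}
    (h : T (ev φ (pr x n))) : T (ev φ (pr x (ev (bmin φ) (pr x n)))) := by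
  rcases zero_or_succ n with rfl | ⟨n, rfl⟩
  · rwa [bmin_zero]
  · by_cases hn : T (ev φ (pr x (ev (bmin φ) (pr x n))))
    · rwa [bmin_succ_of hn]
    · rwa [bmin_succ_not hn]

/-- Once the search has succeeded its value never changes, so the result of `μ` does not depend on
the bound. -/
theorem bmin_add {A : Ob} {φ : Mor E (Ob.prod A Ob.nat) Ob.nat} {x : M.El A} {n : M.El Ob.nat}
    (h : T (ev φ (pr x n))) (k : M.El Ob.nat) :
    ev (bmin φ) (pr x (ev add (pr n k))) = ev (bmin φ) (pr x n) := by
  have := induction (E := E) (A := Ob.prod A Ob.nat)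
    (bimp (φ ⊚ pair (fst ⊚ fst) (bmin φ ⊚ fst))
      (beq (bmin φ ⊚ pair (fst ⊚ fst) (add ⊚ pair (snd ⊚ fst) snd)) (bmin φ ⊚ fst)))
    (by
      intro M z
      obtain ⟨x, n, rfl⟩ := exists_pr z
      simp)
    (by
      intro M z k
      obtain ⟨x, n, rfl⟩ := exists_pr z
      simp only [T_bimp, T_beq, ev_comp, ev_pair, ev_fst_pr, ev_snd_pr, add_succ]
      intro h h'
      rw [bmin_succ_of (by rwa [h h']), h h']) (pr x n) k
  simp only [T_bimp, T_beq, ev_comp, ev_pair, ev_fst_pr, ev_snd_pr] at this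
  exact this (bmin_spec h)

theorem isPartial_mu {A : Obj E} (φ : SMap (A.prod Obj.nat) Obj.two) : (mu φ).IsPartial := by
  rw [isPartial_iff]
  intro M x y y' h h'
  rw [graph_mu] at h h'
  obtain ⟨-, n, h₁, rfl⟩ := h
  obtain ⟨-, n', h₁', rfl⟩ := h'
  -- Both bounds are raised to the common bound `n + n'`.
  rw [← bmin_add h₁ n', ← bmin_add h₁' n, add_comm]

/-! ### Iteration of partial maps -/

/-- The state of the iteration after `n` steps from `a` with the witness `w`. -/
def state {A : Obj E} (f : Rel A A) (a : M.El A.base) (n w : M.El Ob.nat) :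
    M.El (Ob.prod (Ob.prod A.base Ob.nat) Ob.nat) :=
  ev f.run (pr (pr a n) w)

/-- The first component of the state. -/
def val {A : Obj E} (f : Rel A A) (a : M.El A.base) (n w : M.El Ob.nat) : M.El A.base :=
  ev fst (ev fst (f.state a n w))

/-- All steps so far were correct. -/
def Correct {A : Obj E} (f : Rel A A) (a : M.El A.base) (n w : M.El Ob.nat) : Prop :=
  T (ev snd (f.state a n w))

theorem val_zero {A : Obj E} (f : Rel A A) (a : M.El A.base) (w : M.El Ob.nat) :
    f.val a 0 w = a := by
  simp [val, state, run]

theorem state_succ {A : Obj E} (f : Rel A A) (a : M.El A.base) (n w : M.El Ob.nat) :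
    f.state a (ev succ n) w = ev f.step (f.state a n w) := by
  simp [state, run]

theorem Correct.succ {A : Obj E} {f : Rel A A} {a : M.El A.base} {n w : M.El Ob.nat}
    (h : f.Correct a (ev succ n) w) :
    f.Correct a n w ∧ f.Graph (f.val a n w) (f.val a (ev Mor.succ n) w) := by
  unfold Correct Graph val at *
  rw [state_succ] at *
  simp only [step, ev_pair, ev_snd_pr, T_band, T_beq, ev_comp, ev_fst_pr] at *
  exact ⟨h.1, _, h.2.1, h.2.2, rfl⟩

theorem graph_iter {A : Obj E} {f : Rel A A} {a : M.El A.base} {n : M.El Ob.nat}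
    {y : M.El A.base} :
    f.iter.Graph (pr a n) y ↔ T (ev A.pred a) ∧ ∃ w, f.Correct a n w ∧ f.val a n w = y := by
  simp only [Graph, iter, SMap.comp, SMap.fst, SMap.incl, T_band, ev_comp, ev_id, Correct, val,
    state, ev_tt, T_succ, and_true]
  constructor
  · rintro ⟨w, ⟨h₁, h₂⟩, h₃, h₄⟩
    obtain ⟨z, w, rfl⟩ := exists_pr w
    rw [ev_fst_pr] at h₁ h₃
    subst h₃
    exact ⟨by simpa using h₁, w, h₂, h₄⟩
  · rintro ⟨h, w, h₁, h₂⟩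
    exact ⟨pr (pr a n) w, ⟨by simpa using h, h₁⟩, by simp, h₂⟩

/-- Two codes may list different witnesses, but each correct step follows an edge of the same
single-valued graph, so both runs pass through the same values. -/
theorem val_unique {A : Obj E} {f : Rel A A} (hf : f.IsPartial) {a : M.El A.base}
    {n w w' : M.El Ob.nat} (h : f.Correct a n w) (h' : f.Correct a n w') :
    f.val a n w = f.val a n w' := by
  have hP := isPartial_iff.1 hf
  let ρ : Mor E (Ob.prod (Ob.prod (Ob.prod A.base Ob.nat) Ob.nat) Ob.nat) _ :=
    f.run ⊚ pair (pair (fst ⊚ fst ⊚ fst) snd) (snd ⊚ fst ⊚ fst)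
  let ρ' : Mor E (Ob.prod (Ob.prod (Ob.prod A.base Ob.nat) Ob.nat) Ob.nat) _ :=
    f.run ⊚ pair (pair (fst ⊚ fst ⊚ fst) snd) (snd ⊚ fst)
  let p := bimp (band (snd ⊚ ρ) (snd ⊚ ρ')) (beq (fst ⊚ fst ⊚ ρ) (fst ⊚ fst ⊚ ρ'))
  have hp : ∀ {M : Model E} (a : M.El A.base) (n w w' : M.El Ob.nat),
      T (ev p (pr (pr (pr a w) w') n)) ↔ (f.Correct a n w ∧ f.Correct a n w' →
        f.val a n w = f.val a n w') := by
    intro M a n w w'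
    simp [p, ρ, ρ', Correct, val, state]
  refine (hp a n w w').1 (induction p ?_ ?_ _ n) ⟨h, h'⟩
  · intro M z
    obtain ⟨z, w', rfl⟩ := exists_pr z
    obtain ⟨a, w, rfl⟩ := exists_pr z
    rw [hp, val_zero, val_zero]
    exact fun _ => rfl
  · intro M z n
    obtain ⟨z, w', rfl⟩ := exists_pr z
    obtain ⟨a, w, rfl⟩ := exists_pr z
    rw [hp, hp]
    rintro h ⟨h₁, h₂⟩
    obtain ⟨h₃, h₄⟩ := h₁.succ
    obtain ⟨h₅, h₆⟩ := h₂.succ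
    rw [h ⟨h₃, h₅⟩] at h₄
    exact hP M _ _ _ h₄ h₆

theorem IsPartial.iter {A : Obj E} {f : Rel A A} (hf : f.IsPartial) : f.iter.IsPartial := by
  rw [isPartial_iff]
  intro M x y y' h h'
  obtain ⟨a, n, rfl⟩ := exists_pr x
  rw [graph_iter] at h h'
  obtain ⟨-, w, h₁, rfl⟩ := h
  obtain ⟨-, w', h₂, rfl⟩ := h'
  exact val_unique hf h₁ h₂

/-- The correctness flag is a running conjunction, so it cannot recover once it has failed. -/
theorem Correct.of_add {A : Obj E} {f : Rel A A} {a : M.El A.base} {n k w : M.El Ob.nat}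
    (h : f.Correct a (ev add (pr n k)) w) : f.Correct a n w := by
  let ρ : Mor E (Ob.prod (Ob.prod (Ob.prod A.base Ob.nat) Ob.nat) Ob.nat) _ :=
    f.run ⊚ pair (pair (fst ⊚ fst ⊚ fst) (add ⊚ pair (snd ⊚ fst) snd)) (snd ⊚ fst ⊚ fst)
  let ρ' : Mor E (Ob.prod (Ob.prod (Ob.prod A.base Ob.nat) Ob.nat) Ob.nat) _ :=
    f.run ⊚ pair (pair (fst ⊚ fst ⊚ fst) (snd ⊚ fst)) (snd ⊚ fst ⊚ fst)
  let p := bimp (snd ⊚ ρ) (snd ⊚ ρ')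
  have hp : ∀ {M : Model E} (a : M.El A.base) (n w k : M.El Ob.nat),
      T (ev p (pr (pr (pr a w) n) k)) ↔ (f.Correct a (ev add (pr n k)) w → f.Correct a n w) := by
    intro M a n w k
    simp [p, ρ, ρ', Correct, state]
  refine (hp a n w k).1 (induction p ?_ ?_ _ k) h
  · intro M z
    obtain ⟨z, n, rfl⟩ := exists_pr z
    obtain ⟨a, w, rfl⟩ := exists_pr z
    rw [hp, add_zero]
    exact _root_.id
  · intro M z k
    obtain ⟨z, n, rfl⟩ := exists_pr z
    obtain ⟨a, w, rfl⟩ := exists_pr z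
    rw [hp, hp, add_succ]
    exact fun h h' => h h'.succ.1

/-! ### The `μ`-operator on partial predicates -/

variable {A : Obj E} {φ : Rel (A.prod Obj.nat) Obj.two}

theorem graph_next {x : M.El (A.prod Obj.nat).base} {y : M.El (A.prod Obj.nat).base} :
    φ.next.Graph x y ↔ φ.Graph x 0 ∧ y = pr (ev fst x) (ev succ (ev snd x)) := by
  simp only [Graph, next, SMap.comp, SMap.incl, SMap.pair, SMap.fst, SMap.ofNat, T_band, T_bneg,
    ev_comp, ev_id, ev_pair, not_T]
  constructor
  · rintro ⟨w, ⟨h₁, h₂⟩, rfl, rfl⟩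
    exact ⟨⟨w, h₁, rfl, h₂⟩, rfl⟩
  · rintro ⟨⟨w, h₁, rfl, h₂⟩, rfl⟩
    exact ⟨w, ⟨h₁, h₂⟩, rfl, rfl⟩

theorem graph_found {x : M.El (A.prod Obj.nat).base} {y : M.El Ob.nat} :
    φ.found.Graph x y ↔ (∃ t, T t ∧ φ.Graph x t) ∧ y = ev snd x := by
  simp only [Graph, found, SMap.comp, SMap.incl, SMap.snd, T_band, ev_comp, ev_id]
  constructor
  · rintro ⟨w, ⟨h₁, h₂⟩, rfl, rfl⟩
    exact ⟨⟨_, h₂, w, h₁, rfl, rfl⟩, rfl⟩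
  · rintro ⟨⟨t, ht, w, h₁, rfl, rfl⟩, rfl⟩
    exact ⟨w, ⟨h₁, ht⟩, rfl, rfl⟩

theorem val_next {a : M.El A.base} {n w : M.El Ob.nat} (h : φ.next.Correct (pr a 0) n w) :
    φ.next.val (pr a 0) n w = pr a n := by
  let ρ : Mor E (Ob.prod (Ob.prod A.base Ob.nat) Ob.nat) _ :=
    φ.next.run ⊚ pair (pair (pair (fst ⊚ fst) (ff _)) snd) (snd ⊚ fst)
  let p := bimp (snd ⊚ ρ) (beq (fst ⊚ fst ⊚ ρ) (pair (fst ⊚ fst) snd))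
  have hp : ∀ {M : Model E} (a : M.El A.base) (n w : M.El Ob.nat),
      T (ev p (pr (pr a w) n)) ↔ (φ.next.Correct (pr a 0) n w →
        φ.next.val (pr a 0) n w = pr a n) := by
    intro M a n w
    simp [p, ρ, Correct, val, state]
  refine (hp a n w).1 (induction p ?_ ?_ _ n) h
  · intro M z
    obtain ⟨a, w, rfl⟩ := exists_pr z
    rw [hp, val_zero]
    exact fun _ => rfl
  · intro M z n
    obtain ⟨a, w, rfl⟩ := exists_pr z
    rw [hp, hp]
    intro h h₁
    obtain ⟨h₂, h₃⟩ := h₁.succ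
    rw [h h₂, graph_next, ev_fst_pr, ev_snd_pr] at h₃
    exact h₃.2

/-- This direction suffices: only right uniqueness of the unbounded search is used later. The
iteration count `m`, dropped from the domain by `muHat`, is recovered as the value `y`, because the
iterated map merely counts. -/
theorem graph_muHat {a : M.El A.base} {y : M.El Ob.nat} (h : φ.muHat.Graph a y) :
    ∃ w t, φ.next.Correct (pr a 0) y w ∧ T t ∧ φ.Graph (pr a y) t := by
  have h' : ∃ m, φ.least.Graph (pr a m) y := by
    change ∃ w : M.El φ.least.D.base, T (ev φ.least.D.pred w) ∧
      ev (fst ⊚ φ.least.d.tm) w = a ∧ ev φ.least.rule.tm w = y at h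
    obtain ⟨w, h₁, rfl, h₃⟩ := h
    exact ⟨ev snd (ev φ.least.d.tm w), w, h₁, by rw [ev_comp, pr_eta], h₃⟩
  obtain ⟨m, h'⟩ := h'
  rw [least, graph_comp] at h'
  obtain ⟨z, hz, hy⟩ := h'
  rw [graph_comp] at hz
  obtain ⟨u, hu, hz⟩ := hz
  rw [graph_emb] at hu
  obtain rfl : pr (pr a 0) m = u := by
    simpa [SMap.pair, SMap.fst, SMap.snd, SMap.zero] using hu.2
  rw [graph_iter] at hz
  obtain ⟨-, w, hw, hz⟩ := hz
  rw [val_next hw] at hz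
  subst hz
  rw [graph_found] at hy
  obtain ⟨⟨t, ht, hy⟩, h⟩ := hy
  obtain rfl : y = m := by simpa using h
  exact ⟨w, t, hw, ht, hy⟩

/-- A run that goes beyond `n` has made a step at `n`, so the predicate takes the value `0` there;
single-valuedness excludes a true value. -/
theorem eq_zero_of_muHat_aux (hφ : φ.IsPartial) {a : M.El A.base} {n k w t : M.El Ob.nat}
    (hw : φ.next.Correct (pr a 0) (ev add (pr n k)) w) (ht : T t) (h : φ.Graph (pr a n) t) :
    k = 0 := by
  rcases zero_or_succ k with rfl | ⟨k, rfl⟩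
  · rfl
  -- Regrouping as `s n + k` lets the run be cut right after its step at `n`.
  rw [add_succ, ← succ_add] at hw
  obtain ⟨h₁, h₂⟩ := hw.of_add.succ
  rw [val_next h₁, graph_next] at h₂
  exact absurd (isPartial_iff.1 hφ M _ _ _ h h₂.1) ht

theorem IsPartial.muHat (hφ : φ.IsPartial) : φ.muHat.IsPartial := by
  rw [isPartial_iff]
  intro M a y y' h h'
  obtain ⟨w, t, h₁, h₂, h₃⟩ := graph_muHat h
  obtain ⟨w', t', h₁', h₂', h₃'⟩ := graph_muHat h'
  obtain ⟨c, rfl | rfl⟩ := exists_add y y'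
  · rw [eq_zero_of_muHat_aux hφ h₁' h₂ h₃, add_zero]
  · rw [eq_zero_of_muHat_aux hφ h₁ h₂' h₃', add_zero]

/-! ### Right uniqueness of loops and of all generated maps -/

theorem isPartial_wh (χ : SMap A Obj.two) (f : SMap A A) : (wh χ f).IsPartial :=
  (isPartial_emb _).comp (((isPartial_emb _).prod (isPartial_mu _)).comp (isPartial_emb _))

theorem IsPartial.whHat {χ : Rel A Obj.two} {f : Rel A A} (hχ : χ.IsPartial) (hf : f.IsPartial) :
    (whHat χ f).IsPartial :=
  hf.iter.comp (((isPartial_emb _).prod ((isPartial_emb _).comp (hχ.comp hf.iter)).muHat).comp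
    (isPartial_emb _))

end Rel

/-- All that the normal forms need to know about `μ`-recursive maps: however deeply `μ` is nested,
the result is a partial map. -/
theorem MuRec.isPartial {k : ℕ} {A B : Obj E} {f : Rel A B} (h : MuRec E k f) : f.IsPartial := by
  induction h with
  | emb => exact Rel.isPartial_emb _
  | restr => exact Rel.isPartial_restr _ _
  | comp _ _ _ _ _ hg hf => exact hg.comp hf
  | prod _ _ _ _ _ hf hg => exact hf.prod hg
  | iter _ _ _ hf => exact hf.iter
  | mu => exact Rel.isPartial_mu _
  | muHat _ _ _ hφ => exact hφ.muHat

theorem WhileRec.isPartial {k : ℕ} {A B : Obj E} {f : Rel A B} (h : WhileRec E k f) :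
    f.IsPartial := by
  induction h with
  | emb => exact Rel.isPartial_emb _
  | restr => exact Rel.isPartial_restr _ _
  | comp _ _ _ _ _ hg hf => exact hg.comp hf
  | prod _ _ _ _ _ hf hg => exact hf.prod hg
  | wh => exact Rel.isPartial_wh _ _
  | whHat _ _ _ _ _ hχ hf => exact hχ.whHat hf

/-! ## Theories of relations -/

/-- In each model graphs compose as relations do, so the laws are those of relational composition
and hold for any class with identities and composites, even without right uniqueness. -/
theorem Lawful.of_closed {K : RelClass E} (id_mem : ∀ A : Obj E, K (Rel.emb (SMap.id A)))
    (comp_mem : ∀ {A B C : Obj E} {g : Rel B C} {f : Rel A B}, K g → K f → K (g.comp f)) :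
    Lawful K where
  id_mem := id_mem
  comp_mem := comp_mem
  refl _ := Rel.pEq_iff.2 fun _ _ _ => Iff.rfl
  symm _ _ h := And.symm h
  trans _ _ _ h h' := by
    rw [Rel.pEq_iff] at *
    exact fun M x y => (h M x y).trans (h' M x y)
  comp_congr _ _ _ _ h h' := by
    rw [Rel.pEq_iff] at *
    intro M x z
    simp only [Rel.graph_comp, h', h]
  id_comp _ := by
    rw [Rel.pEq_iff]
    intro M x z
    simp only [Rel.graph_comp, Rel.graph_emb, SMap.id, ev_id]
    exact ⟨by rintro ⟨y, h, -, rfl⟩; exact h, fun h => ⟨z, h, h.cod, rfl⟩⟩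
  comp_id _ := by
    rw [Rel.pEq_iff]
    intro M x z
    simp only [Rel.graph_comp, Rel.graph_emb, SMap.id, ev_id]
    exact ⟨by rintro ⟨y, ⟨-, rfl⟩, h⟩; exact h, fun h => ⟨x, ⟨h.dom, rfl⟩, h⟩⟩
  assoc _ _ _ := by
    rw [Rel.pEq_iff]
    intro M x z
    simp only [Rel.graph_comp]
    exact ⟨by rintro ⟨y, h, v, h', h''⟩; exact ⟨v, ⟨y, h, h'⟩, h''⟩,
      by rintro ⟨v, ⟨y, h, h'⟩, h''⟩; exact ⟨y, h, v, h', h''⟩⟩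

theorem lawful_hat : Lawful (Hat E) :=
  Lawful.of_closed (fun _ => Rel.isPartial_emb _) fun hg hf => Rel.IsPartial.comp hg hf

theorem lawful_muRec (k : ℕ) : Lawful (MuRec E k) :=
  Lawful.of_closed (fun _ => MuRec.emb _ _) fun hg hf => MuRec.comp _ _ _ hg hf

theorem lawful_whileRec (k : ℕ) : Lawful (WhileRec E k) :=
  Lawful.of_closed (fun _ => WhileRec.emb _ _) fun hg hf => WhileRec.comp _ _ _ hg hf

/-- Faithfulness is automatic because both sides use the same partial equality, and the functor is
the identity on objects; only fullness needs the representatives in `h`. -/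
theorem inclusionEquiv_of {K L : RelClass E} (hK : Lawful K) (hL : Lawful L)
    (hKL : ∀ ⦃A B : Obj E⦄ (f : Rel A B), K f → L f)
    (h : ∀ ⦃A B : Obj E⦄ (f : Rel A B), L f → ∃ g : Rel A B, K g ∧ g.PEq f) :
    InclusionEquiv K L := by
  refine ⟨hK, hL, hKL, ?_⟩
  have h₁ : (inclusion hK hL hKL).Faithful := ⟨by
    intro A B f g hfg
    induction f using Quotient.ind with | _ f =>
    induction g using Quotient.ind with | _ g =>
    exact Quotient.sound (s := homSetoid K hK A B)
      (Quotient.exact (s := homSetoid L hL A B) hfg)⟩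
  have h₂ : (inclusion hK hL hKL).Full := ⟨by
    intro A B f
    induction f using Quotient.ind with | _ f =>
    obtain ⟨g, hg, hgf⟩ := h f.1 f.2
    exact ⟨Quotient.mk (homSetoid K hK A B) ⟨g, hg⟩,
      Quotient.sound (s := homSetoid L hL A B) hgf⟩⟩
  have h₃ : (inclusion hK hL hKL).EssSurj := ⟨fun A => ⟨A, ⟨Iso.refl _⟩⟩⟩
  exact {}

/-! ## Normal forms of partial maps -/

namespace Rel

variable {M : Model E} {A B : Obj E}

theorem T_phi {f : Rel A B} {x : M.El A.base} {n : M.El Ob.nat} :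
    T (ev f.phi.tm (pr x n)) ↔
      T (ev f.D.pred (ev (cnt _) n)) ∧ x = ev f.d.tm (ev (cnt _) n) := by
  simp [phi, SMap.ofPred]

/-- The graph of a partial map in terms of the count of its domain. -/
theorem graph_iff_phi {f : Rel A B} (hf : f.IsPartial) {x : M.El A.base} {y : M.El B.base} :
    f.Graph x y ↔ T (ev A.pred x) ∧ ∃ n, T (ev f.phi.tm (pr x n)) ∧
      ev f.rule.tm (ev (cnt _) (ev (bmin f.phi.tm) (pr x n))) = y := by
  constructor
  · rintro ⟨w, hw, rfl, rfl⟩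
    obtain ⟨n, rfl⟩ := cnt_surjective _ w
    have hn : T (ev f.phi.tm (pr (ev f.d.tm (ev (cnt _) n)) n)) := T_phi.2 ⟨hw, rfl⟩
    refine ⟨f.d.ev_ok hw, n, hn, ?_⟩
    obtain ⟨h₁, h₂⟩ := T_phi.1 (bmin_spec hn)
    -- The search may stop at a witness other than `w`; right uniqueness of `f` makes the two rule
    -- values equal.
    exact isPartial_iff.1 hf M _ _ _ ⟨_, h₁, h₂.symm, rfl⟩ ⟨_, hw, rfl, rfl⟩
  · rintro ⟨-, n, hn, rfl⟩
    obtain ⟨h₁, h₂⟩ := T_phi.1 (bmin_spec hn)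
    exact ⟨_, h₁, h₂.symm, rfl⟩

theorem pEq_cntRule_comp_mu {f : Rel A B} (hf : f.IsPartial) :
    f.PEq (f.cntRule.comp (mu f.phi)) := by
  rw [pEq_iff]
  intro M x y
  rw [graph_iff_phi hf, graph_comp]
  simp only [graph_mu, cntRule, graph_restr, SMap.ofPred, ev_comp, ev_tt, T_succ, true_and]
  constructor
  · rintro ⟨h, n, hn, rfl⟩
    exact ⟨_, ⟨h, n, hn, rfl⟩, (T_phi.1 (bmin_spec hn)).1, rfl⟩
  · rintro ⟨_, ⟨h, n, hn, rfl⟩, -, rfl⟩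
    exact ⟨h, n, hn, rfl⟩

theorem pEq_emb_comp_mu {f : Rel A B} (hf : f.IsPartial) (q : SMap Obj.nat B)
    (hq : q.tm = f.rule.tm ⊚ cnt f.D.base) : f.PEq ((emb q).comp (mu f.phi)) := by
  rw [pEq_iff]
  intro M x y
  rw [graph_iff_phi hf, graph_comp]
  simp only [graph_mu, graph_emb, hq, ev_comp, ev_tt, T_succ, true_and]
  constructor
  · rintro ⟨h, n, hn, rfl⟩
    exact ⟨_, ⟨h, n, hn, rfl⟩, rfl⟩
  · rintro ⟨_, ⟨h, n, hn, rfl⟩, rfl⟩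
    exact ⟨h, n, hn, rfl⟩

theorem oneMu {f : Rel A B} (hf : f.IsPartial) : OneMu f :=
  ⟨f.phi, _, _, pEq_cntRule_comp_mu hf⟩

/-! ### The normal form with a single loop -/

theorem graph_wh {χ : SMap A Obj.two} {f : SMap A A} {x y : M.El A.base} :
    (wh χ f).Graph x y ↔ T (ev A.pred x) ∧ ∃ n, ¬ T (ev χ.tm (ev (Mor.iter f.tm) (pr x n))) ∧
      ev (Mor.iter f.tm) (pr x (ev (bmin (neg ⊚ χ.tm ⊚ Mor.iter f.tm)) (pr x n))) = y := by
  simp only [wh, graph_comp, graph_emb]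
  constructor
  · rintro ⟨z, ⟨_, ⟨hx, rfl⟩, h⟩, -, rfl⟩
    obtain ⟨x', m, rfl⟩ := exists_pr z
    simp only [SMap.pair, SMap.id, ev_pair, ev_id, graph_prod, graph_emb, graph_mu] at h
    obtain ⟨⟨-, rfl⟩, -, n, hn, rfl⟩ := h
    refine ⟨hx, n, ?_, rfl⟩
    simpa [SMap.not, SMap.comp, SMap.iter, SMap.ofPred] using hn
  · rintro ⟨hx, n, hn, rfl⟩
    refine ⟨pr x _, ⟨_, ⟨hx, rfl⟩, ?_⟩, ?_, rfl⟩
    · simp only [SMap.pair, SMap.id, ev_pair, ev_id, graph_prod, graph_emb, graph_mu]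
      refine ⟨⟨hx, trivial⟩, hx, n, ?_, rfl⟩
      simpa [SMap.not, SMap.comp, SMap.iter, SMap.ofPred] using hn
    · simpa using hx

/-- The counter `(a, n) ↦ (a, s n)`. -/
def count (A : Obj E) : SMap (A.prod Obj.nat) (A.prod Obj.nat) :=
  SMap.fst.pair (SMap.ofNat (succ ⊚ Mor.snd))

theorem iter_count (a : M.El A.base) (n : M.El Ob.nat) :
    ev (Mor.iter (count A).tm) (pr (pr a 0) n) = pr a n := by
  have := induction (beq (Mor.iter (count A).tm ⊚ pair (pair Mor.fst (ff _)) Mor.snd) (Mor.id _))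
    (by simp) (by
      intro M a n
      simp only [T_beq, ev_comp, ev_pair, ev_fst_pr, ev_snd_pr, ev_ff, ev_id, ev_iter_succ]
      intro h
      rw [h]
      simp [count, SMap.pair, SMap.fst, SMap.ofNat]) a n
  simpa using this

theorem not_phi_ok (f : Rel A B) : sign ⊚ bneg f.phi.tm = bneg f.phi.tm := by
  simp [bneg, sign_neg]

/-- The rule of a partial map after the count, on pairs with a correct index. -/
def pairRule (f : Rel A B) : SMap ((A.prod Obj.nat).ext f.phi.tm) B :=
  ⟨f.rule.tm ⊚ cnt f.D.base ⊚ Mor.snd, entails_iff_ev.2 fun M z hz => by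
    obtain ⟨x, n, rfl⟩ := exists_pr z
    rw [T_band] at hz
    simpa using f.rule.ev_ok (T_phi.1 hz.2).1⟩

/-- After `n` rounds from `(x, 0)` the counter is at `(x, n)`, so the stopping test of the loop is
the doubly negated `φ_f`, and both searches take the same branch at each bound. -/
theorem bmin_iter_count (f : Rel A B) (x : M.El A.base) (n : M.El Ob.nat) :
    ev (bmin (neg ⊚ bneg f.phi.tm ⊚ Mor.iter (count A).tm)) (pr (pr x 0) n) =
      ev (bmin f.phi.tm) (pr x n) := by
  have := induction
    (beq (bmin (neg ⊚ bneg f.phi.tm ⊚ Mor.iter (count A).tm) ⊚ pair (pair Mor.fst (ff _)) Mor.snd)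
      (bmin f.phi.tm)) (by simp [bmin_zero]) (by
      intro M a n
      simp only [T_beq, ev_comp, ev_pair, ev_fst_pr, ev_snd_pr, ev_ff]
      intro h
      by_cases hn : T (ev f.phi.tm (pr a (ev (bmin f.phi.tm) (pr a n))))
      · rw [bmin_succ_of hn, bmin_succ_of, h]
        rw [h]
        simpa [iter_count] using hn
      · rw [bmin_succ_not hn, bmin_succ_not]
        rw [h]
        simpa [iter_count] using hn) x n
  simpa using this

theorem graph_count_loop (f : Rel A B) {x : M.El A.base} {z : M.El (Ob.prod A.base Ob.nat)} :
    ((wh (SMap.ofPred (bneg f.phi.tm) f.not_phi_ok) (count A)).comp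
      (emb ((SMap.id A).pair (SMap.zero A)))).Graph x z ↔
    T (ev A.pred x) ∧ ∃ n, T (ev f.phi.tm (pr x n)) ∧ pr x (ev (bmin f.phi.tm) (pr x n)) = z := by
  have h₀ : ev ((SMap.id A).pair (SMap.zero A)).tm x = pr x 0 := by
    simp [SMap.pair, SMap.id, SMap.zero]
  simp only [graph_comp, graph_emb, h₀]
  constructor
  · rintro ⟨_, ⟨hx, rfl⟩, h⟩
    rw [graph_wh] at h
    obtain ⟨-, n, hn, rfl⟩ := h
    refine ⟨hx, n, by simpa [SMap.ofPred, iter_count] using hn, ?_⟩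
    simp only [SMap.ofPred, bmin_iter_count, iter_count]
  · rintro ⟨hx, n, hn, rfl⟩
    refine ⟨_, ⟨hx, rfl⟩, graph_wh.2 ⟨by simpa using hx, n, ?_, ?_⟩⟩
    · simpa [SMap.ofPred, iter_count] using hn
    · simp only [SMap.ofPred, bmin_iter_count, iter_count]

theorem oneWhile {f : Rel A B} (hf : f.IsPartial) : OneWhile f := by
  -- The loop starts at `(a, 0)` and raises the index while `φ_f` fails. Its exit state is a pair
  -- with a correct index, to which the rule after the count is applied.
  refine ⟨A.prod Obj.nat, (SMap.id A).pair (SMap.zero A),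
    SMap.ofPred (bneg f.phi.tm) f.not_phi_ok, count A, f.phi, f.pairRule, ?_, ?_⟩
  · rw [pEq_iff]
    intro M x y
    rw [graph_iff_phi hf, graph_comp]
    simp only [graph_count_loop, graph_restr, pairRule, ev_comp]
    constructor
    · rintro ⟨hx, n, hn, rfl⟩
      exact ⟨_, ⟨hx, n, hn, rfl⟩, by simpa using hx, bmin_spec hn, by simp⟩
    · rintro ⟨_, ⟨hx, n, hn, rfl⟩, -, -, rfl⟩
      exact ⟨hx, n, hn, by simp⟩
  -- The exit state satisfies `φ_f` in any case, so dropping the restriction on the last map adds no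
  -- new pairs to the graph.
  · intro q hq
    rw [pEq_iff]
    intro M x y
    rw [graph_iff_phi hf, graph_comp]
    simp only [graph_count_loop, graph_emb, hq, pairRule, ev_comp]
    constructor
    · rintro ⟨hx, n, hn, rfl⟩
      exact ⟨_, ⟨hx, n, hn, rfl⟩, by simpa using hx, by simp⟩
    · rintro ⟨_, ⟨hx, n, hn, rfl⟩, -, rfl⟩
      exact ⟨hx, n, hn, by simp⟩

end Rel

/-! ### Equivalences from the normal forms -/

theorem exists_muRec {k : ℕ} (hk : 1 ≤ k) {A B : Obj E} {f : Rel A B} (hf : f.IsPartial) :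
    ∃ g : Rel A B, MuRec E k g ∧ g.PEq f := by
  obtain ⟨k, rfl⟩ := Nat.exists_eq_add_of_le' hk
  exact ⟨_, .comp _ _ _ (.restr _ _ _) (.mu k f.phi), (Rel.pEq_cntRule_comp_mu hf).symm⟩

theorem exists_whileRec {k : ℕ} (hk : 1 ≤ k) {A B : Obj E} {f : Rel A B} (hf : f.IsPartial) :
    ∃ g : Rel A B, WhileRec E k g ∧ g.PEq f := by
  obtain ⟨k, rfl⟩ := Nat.exists_eq_add_of_le' hk
  obtain ⟨C, p, χ, g, γ, q, h, -⟩ := Rel.oneWhile hf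
  exact ⟨_, .comp _ _ _ (.restr _ _ _) (.comp _ _ _ (.wh k χ g) (.emb _ _)), h.symm⟩

/-- Every generating rule available at level one is available at each positive level; the rule for
partial predicates starts only at level two. -/
theorem MuRec.of_one {k : ℕ} (hk : 1 ≤ k) {A B : Obj E} {f : Rel A B} (hf : MuRec E 1 f) :
    MuRec E k f := by
  obtain ⟨k, rfl⟩ := Nat.exists_eq_add_of_le' hk
  generalize h : 1 = j at hf
  induction hf with
  | emb => exact .emb _ _
  | restr => exact .restr _ _ _
  | comp _ _ _ _ _ hg hf => exact .comp _ _ _ (hg h) (hf h)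
  | prod _ _ _ _ _ hf hg => exact .prod _ _ _ (hf h) (hg h)
  | iter _ _ _ hf => exact .iter _ _ (hf h)
  | mu => exact .mu _ _
  | muHat => omega

theorem inclusionEquiv_muRec (k : ℕ) (hk : 1 ≤ k) : InclusionEquiv (MuRec E 1) (MuRec E k) :=
  inclusionEquiv_of (lawful_muRec 1) (lawful_muRec k) (fun _ _ _ h => h.of_one hk)
    fun _ _ _ h => exists_muRec le_rfl h.isPartial

end PRM

theorem mainTheorem3 (E : PRM.Eqns) :
    (∀ (A B : PRM.Obj E) (f : PRM.Rel A B), f.IsPartial →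
      (PRM.Rel.mu f.phi).IsPartial ∧
      (f.cntRule.comp (PRM.Rel.mu f.phi)).IsPartial ∧
      f.PEq (f.cntRule.comp (PRM.Rel.mu f.phi)) ∧
      ∀ q : PRM.SMap PRM.Obj.nat B, q.tm = PRM.Mor.comp f.rule.tm (PRM.Mor.cnt f.D.base) →
        f.PEq ((PRM.Rel.emb q).comp (PRM.Rel.mu f.phi))) ∧
    (∀ k : ℕ, 1 ≤ k → PRM.InclusionEquiv (PRM.MuRec E k) (PRM.Hat E)) ∧
    PRM.InclusionEquiv (PRM.MuRec E 1) (PRM.MuRec E 2) ∧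
    (∀ k : ℕ, 1 ≤ k → PRM.InclusionEquiv (PRM.MuRec E 1) (PRM.MuRec E k)) ∧
    (∀ (k : ℕ) (A B : PRM.Obj E) (f : PRM.Rel A B), PRM.MuRec E k f → PRM.OneMu f) ∧
    (∀ (A B : PRM.Obj E) (f : PRM.Rel A B), f.IsPartial → PRM.OneWhile f) ∧
    (∀ k : ℕ, 1 ≤ k → PRM.InclusionEquiv (PRM.WhileRec E k) (PRM.Hat E)) ∧
    (∀ (k : ℕ) (A B : PRM.Obj E) (f : PRM.Rel A B), PRM.WhileRec E k f → PRM.OneWhile f) := by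
  refine ⟨fun A B f hf => ⟨PRM.Rel.isPartial_mu _,
      (PRM.Rel.isPartial_restr _ _).comp (PRM.Rel.isPartial_mu _),
      PRM.Rel.pEq_cntRule_comp_mu hf, PRM.Rel.pEq_emb_comp_mu hf⟩, fun k hk => ?_,
    PRM.inclusionEquiv_muRec 2 one_le_two, PRM.inclusionEquiv_muRec,
    -- Nested uses of `μ` or of loops are not unwound one by one: right uniqueness of the whole map
    -- suffices for a single search.
    fun k A B f hf => PRM.Rel.oneMu hf.isPartial, fun A B f hf => PRM.Rel.oneWhile hf,
    fun k hk => ?_, fun k A B f hf => PRM.Rel.oneWhile hf.isPartial⟩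
  · exact PRM.inclusionEquiv_of (PRM.lawful_muRec k) PRM.lawful_hat
      (fun _ _ _ h => h.isPartial) fun _ _ _ h => PRM.exists_muRec hk h
  · exact PRM.inclusionEquiv_of (PRM.lawful_whileRec k) PRM.lawful_hat
      (fun _ _ _ h => h.isPartial) fun _ _ _ h => PRM.exists_whileRec hk h
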